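/- Let $Q$ be the generator of an irreducible continuous-time Markov chain on a finite state space $V$ which is reversible with respect to its invariant distribution $\pi$, and let $(X_t)_{t\ge 0}$ and $(Y_t)_{t\ge 0}$ be two independent (right-continuous) chains with generator $Q$. Write $\mathbb E_{x,y}$ for the expectation when $X_0=x$, $Y_0=y$, put $\pi(A)=\sum_{i\in A}\pi(i)$ and $$t_{\rm hit}(s)=\max_{x\in V}\mathbb E_x\big(\inf\{t\ge 0: X_t=s\}\big),\qquad t_{\rm meet}=\max_{x,y\in V}\mathbb E_{x,y}\big(\inf\{t\ge 0: X_t=Y_t\}\big).$$ For a nonempty set $A\subseteq V$, let $U(t)=\int_0^t \mathbf 1_{A\times A}(X_r,Y_r)\,dr$, let $U^{-1}(u)=\inf\{t\ge 0: U(t)>u\}$, and let $(\tilde X_u,\tilde Y_u)=(X_{U^{-1}(u)},Y_{U^{-1}(u)})$ be the product chain observed on $A\times A$, with meeting time $\tau_{\rm meet}(A)=\inf\{u\ge 0:\tilde X_u=\tilde Y_u\}$. Let $t^\pi_{\rm meet}(A)$ be the expectation of $\tau_{\rm meet}(A)$ when the observed chain is started from its stationary distribution $\pi_A\otimes\pi_A$,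 where $\pi_A(\cdot)=\pi(\cdot)\mathbf 1_A(\cdot)/\pi(A)$. Then, for every state $s\in V$ and every nonempty $A\subseteq V$, $$t_{\rm meet}\;\le\; 188\,t_{\rm hit}(s)+\frac{2\,t^\pi_{\rm meet}(A)}{\pi(A)^2}+\frac{1568\,t_{\rm hit}(s)}{\pi(A)^4}.$$ The same inequality holds if instead $t^\pi_{\rm meet}(A)$ denotes the expectation of $\tau_{\rm meet}(A)$ when the full product chain is started from $(X_0,Y_0)\sim\pi\otimes\pi$. -/

import Mathlib

open MeasureTheory
open scoped NNReal ENNReal Topology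

namespace CTMC

section Chain

variable {V : Type*} [Fintype V]

/-- `Q` is a matrix of transition rates (a generator): nonnegative off the diagonal, with
rows summing to zero. -/
structure IsGenerator (Q : Matrix V V ℝ) : Prop where
  nonneg : ∀ i j, i ≠ j → 0 ≤ Q i j
  row_sum : ∀ i, ∑ j, Q i j = 0

/-- Every state can be reached from every state along transitions of positive rate. -/
def IsIrreducible (Q : Matrix V V ℝ) : Prop :=
  ∀ i j, Relation.ReflTransGen (fun a b => 0 < Q a b) i j

/-- `π` is an invariant probability vector of `Q`. -/
structure IsInvariant (Q : Matrix V V ℝ) (π : V → ℝ) : Prop where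
  nonneg : ∀ i, 0 ≤ π i
  sum_one : ∑ i, π i = 1
  invariant : ∀ j, ∑ i, π i * Q i j = 0

/-- Reversibility of `Q` with respect to `π` (detailed balance). -/
def IsReversible (Q : Matrix V V ℝ) (π : V → ℝ) : Prop :=
  ∀ i j, π i * Q i j = π j * Q j i

/-- The transition function `p_t = exp (t Q)`. -/
noncomputable def trans [DecidableEq V] (Q : Matrix V V ℝ) (t : ℝ≥0) : Matrix V V ℝ :=
  NormedSpace.exp ((t : ℝ) • Q)

/-- `X` is, under the laws `(P x)`, the continuous-time Markov chain with generator `Q`, where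
`P x` is the law of the chain started in `x`. The paths are right-continuous (for the discrete
topology), and the Markov property is stated through finite-dimensional distributions. -/
structure IsMarkovChain [DecidableEq V] {Ω : Type*} [MeasurableSpace Ω]
    (Q : Matrix V V ℝ) (P : V → Measure Ω) (X : ℝ≥0 → Ω → V) : Prop where
  isProbabilityMeasure : ∀ x, IsProbabilityMeasure (P x)
  measurableSet_eq : ∀ t v, MeasurableSet {ω | X t ω = v}
  rightContinuous : ∀ ω t, ∀ᶠ u in 𝓝[≥] t, X u ω = X t ω
  start : ∀ x, ∀ᵐ ω ∂(P x), X 0 ω = x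
  markov : ∀ (x : V) (k : ℕ) (t : ℕ → ℝ≥0) (v : ℕ → V), Monotone t →
    P x {ω | ∀ i ≤ k + 1, X (t i) ω = v i} =
      P x {ω | ∀ i ≤ k, X (t i) ω = v i} *
        ENNReal.ofReal (trans Q (t (k + 1) - t k) (v k) (v (k + 1)))

end Chain

section Times

variable {Ω S : Type*}

/-- `inf {t ≥ 0 : Z_t ∈ B}`, which is `∞` if `B` is never visited. -/
noncomputable def hitTime (Z : ℝ≥0 → Ω → S) (B : Set S) (ω : Ω) : ℝ≥0∞ :=
  ⨅ (t : ℝ≥0) (_ : Z t ω ∈ B), (t : ℝ≥0∞)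

/-- The clock `U(t) = ∫_0^t 1_B(Z_s) ds`. -/
noncomputable def clock (Z : ℝ≥0 → Ω → S) (B : Set S) (t : ℝ≥0) (ω : Ω) : ℝ≥0∞ :=
  ∫⁻ r in Set.Icc (0 : ℝ) t, B.indicator 1 (Z r.toNNReal ω)

/-- The right-continuous inverse `U⁻¹(u) = inf {t ≥ 0 : U(t) > u}` of the clock. (For the chains
considered here, the set is nonempty for all `u` almost surely, by recurrence.) -/
noncomputable def clockInv (Z : ℝ≥0 → Ω → S) (B : Set S) (u : ℝ≥0) (ω : Ω) : ℝ≥0 :=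
  sInf {t : ℝ≥0 | (u : ℝ≥0∞) < clock Z B t ω}

/-- The process `Z` observed on `B`: `u ↦ Z_{U⁻¹(u)}`. -/
noncomputable def observed (Z : ℝ≥0 → Ω → S) (B : Set S) (u : ℝ≥0) (ω : Ω) : S :=
  Z (clockInv Z B u ω) ω

end Times

section Expectations

variable {V Ω : Type*} [MeasurableSpace Ω]

/-- The product chain: two copies of `X`, which are independent under `(P x).prod (P y)`. -/
def pair (X : ℝ≥0 → Ω → V) (t : ℝ≥0) (ω : Ω × Ω) : V × V := (X t ω.1, X t ω.2)

/-- `t_hit(s) = max_x E_x (T_s)`. -/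
noncomputable def tHit (P : V → Measure Ω) (X : ℝ≥0 → Ω → V) (s : V) : ℝ≥0∞ :=
  ⨆ x, ∫⁻ ω, hitTime X {s} ω ∂(P x)

/-- `t_meet = max_{x, y} E_{x, y} (τ_meet)`, where `τ_meet = inf {t ≥ 0 : X_t = Y_t}`. -/
noncomputable def tMeet (P : V → Measure Ω) (X : ℝ≥0 → Ω → V) : ℝ≥0∞ :=
  ⨆ (x : V) (y : V), ∫⁻ ω, hitTime (pair X) (Set.diagonal V) ω ∂((P x).prod (P y))

/-- Meeting time of the product chain observed on `A × A`. -/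
noncomputable def obsMeetTime (X : ℝ≥0 → Ω → V) (A : Finset V) : Ω × Ω → ℝ≥0∞ :=
  hitTime (observed (pair X) ((A : Set V) ×ˢ (A : Set V))) (Set.diagonal V)

/-- Expected meeting time of the product chain observed on `A × A`, when the two independent
chains `X`, `Y` both have initial distribution `ν`. -/
noncomputable def tMeetObs [Fintype V] (P : V → Measure Ω) (X : ℝ≥0 → Ω → V)
    (A : Finset V) (ν : V → ℝ) : ℝ≥0∞ :=
  ∑ x, ∑ y, ENNReal.ofReal (ν x * ν y) * ∫⁻ ω, obsMeetTime X A ω ∂((P x).prod (P y))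

/-- The distribution `π` conditioned on `A`, `π(·) 1_A(·) / π(A)`. The product chain observed on
`A × A` has as its stationary distribution the product of two copies of it. -/
noncomputable def condDist [DecidableEq V] (π : V → ℝ) (A : Finset V) (i : V) : ℝ :=
  if i ∈ A then π i / ∑ j ∈ A, π j else 0

end Expectations

end CTMC

/-!
The meeting time is compared with the time spent in `A × A` before meeting, by way of the mixing of
the chain within a multiple of `h = t_hit(s)`.

*Mixing.* By reversibility `p_t(s, s) ≥ π(s)` for all `t`, so the first-passage decomposition at `s`
gives `p_t(x, s) ≥ π(s) P_x(T_s ≤ t) ≥ π(s) (1 - h / t)`. By reversibility again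
`p_t(s, y) ≥ π(y) (1 - h / t)`, and a second first-passage decomposition yields
`p_{2t}(x, y) ≥ π(y) (1 - h / t)²` (`CTMC.le_trans_of_tHit_le`, with `t = 5 h`). Hence the pair of
chains satisfies a Doeblin condition with respect to `μ = π ⊗ π` at time `T = 10 h`, with a constant
`ε`.

*Comparison.* Let `D` be the diagonal, `B = A × A`, `a = μ(B) = π(A)²`, and for the pair of chains
killed on `D` let `m(z)` be the expected lifetime and `f(z)` the expected time spent in `B`.
The Doeblin condition gives `m(z) ≤ T / (ε a) + ∑_B μ m / a` (`CTMC.occ_one_le_sum`).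
Reversibility of the killed chain turns `∑_B μ m` into `∑ μ f`, which settles the start from `π ⊗ π`
(`CTMC.occ_one_le_stationary`). For the start from `π_A ⊗ π_A`, the function `g = 1 - 1_B / a` is
centred, so the integrals of `P_t g` over `[0, t]` are bounded by `T / (ε a)`
(`CTMC.abs_sum_pow_mulVec_le`). By the maximum principle the same integral for the killed chain, which
is `m - f / a` in the limit, is at most `2 T / (ε a)` (`CTMC.occ_le_of_abs_sum_le`); it remains to
average over `B` (`CTMC.occ_one_le_conditioned`). In both cases
`m(z) ≤ 74 h / a + (mean of f) / a`, which is more than enough as `a ≤ 1`.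

*Paths.* The mean of `f` is at most the expected meeting time of the observed process, since up to
meeting the clock of the latter is the time spent in `B` (`CTMC.pathOcc_le_hitTime_observed`).

All comparisons are proved for the chain sampled at the times `i T / 2 ^ n`, where the law of the
killed chain is an explicit product of matrices (`CTMC.IsMarkovProcess.measure_grid`) and the maximum
principle is an induction on the number of steps. Right-continuity of the paths and the reverse Fatou
lemma carry them over to continuous time (`CTMC.IsMarkovProcess.lintegral_hitTime_le`,
`CTMC.IsMarkovProcess.le_mulVec_of_le_at`).
-/

namespace CTMC

/-! ### Killed Markov chains in discrete time -/

section Discrete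

open Matrix

variable {S : Type*} [Fintype S] [DecidableEq S]

/-- The projection onto the functions that vanish on `D`, as a diagonal matrix. -/
noncomputable def offProj (D : Set S) : Matrix S S ℝ := diagonal (Dᶜ.indicator 1)

/-- The `j`-step transition matrix of the chain with transition matrix `A` killed on `D`; time `0`
counts, so that the rows and columns indexed by `D` vanish for every `j`. -/
noncomputable def killed (A : Matrix S S ℝ) (D : Set S) (j : ℕ) : Matrix S S ℝ :=
  (offProj D * A) ^ j * offProj D

/-- The expected sum of `f` along the killed chain during its first `j` steps, as a function of the
starting point. -/
noncomputable def occ (A : Matrix S S ℝ) (D : Set S) (f : S → ℝ) (j : ℕ) : S → ℝ :=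
  ∑ i ∈ Finset.range j, killed A D i *ᵥ f

lemma offProj_mulVec (D : Set S) (f : S → ℝ) : offProj D *ᵥ f = Dᶜ.indicator f := by
  ext z
  by_cases hz : z ∈ D <;> simp [offProj, mulVec_diagonal, hz]

lemma killed_succ (A : Matrix S S ℝ) (D : Set S) (j : ℕ) :
    killed A D (j + 1) = killed A D j * A * offProj D := by
  simp only [killed, pow_succ, Matrix.mul_assoc]

lemma killed_succ_mulVec (A : Matrix S S ℝ) (D : Set S) (j : ℕ) (f : S → ℝ) :
    killed A D (j + 1) *ᵥ f = Dᶜ.indicator (A *ᵥ (killed A D j *ᵥ f)) := by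
  rw [← offProj_mulVec]
  simp only [killed, pow_succ', Matrix.mul_assoc, mulVec_mulVec]

lemma killed_zero_mulVec (A : Matrix S S ℝ) (D : Set S) (f : S → ℝ) :
    killed A D 0 *ᵥ f = Dᶜ.indicator f := by
  simp [killed, offProj_mulVec]

lemma occ_succ (A : Matrix S S ℝ) (D : Set S) (f : S → ℝ) (j : ℕ) :
    occ A D f (j + 1) = Dᶜ.indicator (f + A *ᵥ occ A D f j) := by
  rw [occ, Finset.sum_range_succ', killed_zero_mulVec]
  simp only [killed_succ_mulVec, occ, ← offProj_mulVec, mulVec_sum, mulVec_add, add_comm]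

lemma occ_zero (A : Matrix S S ℝ) (D : Set S) (f : S → ℝ) : occ A D f 0 = 0 := by
  simp [occ]

lemma mulVec_mono {A : Matrix S S ℝ} (hA : A ∈ rowStochastic ℝ S) {f g : S → ℝ}
    (h : ∀ z, f z ≤ g z) (z : S) : (A *ᵥ f) z ≤ (A *ᵥ g) z :=
  Finset.sum_le_sum fun w _ =>
    mul_le_mul_of_nonneg_left (h w) (nonneg_of_mem_rowStochastic hA)

lemma mulVec_add_const {A : Matrix S S ℝ} (hA : A ∈ rowStochastic ℝ S) (f : S → ℝ) (c : ℝ) (z : S) :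
    (A *ᵥ fun w => f w + c) z = (A *ᵥ f) z + c := by
  simp only [mulVec, dotProduct, mul_add, Finset.sum_add_distrib, ← Finset.sum_mul,
    sum_row_of_mem_rowStochastic hA, one_mul]

lemma killed_mulVec_nonneg {A : Matrix S S ℝ} (hA : A ∈ rowStochastic ℝ S) (D : Set S)
    {f : S → ℝ} (hf : ∀ z, 0 ≤ f z) (j : ℕ) (z : S) : 0 ≤ (killed A D j *ᵥ f) z := by
  induction j generalizing z with
  | zero =>
    rw [killed_zero_mulVec]
    exact Set.indicator_nonneg (fun w _ => hf w) z
  | succ j ih =>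
    rw [killed_succ_mulVec]
    refine Set.indicator_nonneg (fun w _ => ?_) z
    exact Finset.sum_nonneg fun v _ => mul_nonneg (nonneg_of_mem_rowStochastic hA) (ih v)

lemma occ_nonneg {A : Matrix S S ℝ} (hA : A ∈ rowStochastic ℝ S) (D : Set S)
    {f : S → ℝ} (hf : ∀ z, 0 ≤ f z) (j : ℕ) (z : S) : 0 ≤ occ A D f j z := by
  rw [occ, Finset.sum_apply]
  exact Finset.sum_nonneg fun i _ => killed_mulVec_nonneg hA D hf i z

lemma occ_le_succ {A : Matrix S S ℝ} (hA : A ∈ rowStochastic ℝ S) (D : Set S)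
    {f : S → ℝ} (hf : ∀ z, 0 ≤ f z) (j : ℕ) (z : S) : occ A D f j z ≤ occ A D f (j + 1) z := by
  rw [occ, occ, Finset.sum_range_succ, Pi.add_apply]
  exact le_add_of_nonneg_right (killed_mulVec_nonneg hA D hf j z)

/-- First-passage bound: if the harmonic extension `A ^ k u` stays above `c` at every point of `D`,
then at any point it is at least `c` times the probability that `D` is reached within `n` steps. -/
lemma le_pow_mulVec_of_le_on {A : Matrix S S ℝ} (hA : A ∈ rowStochastic ℝ S) (D : Set S)
    {u : S → ℝ} (hu : ∀ z, 0 ≤ u z) {c : ℝ} (n : ℕ)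
    (h : ∀ k ≤ n, ∀ s ∈ D, c ≤ (A ^ k *ᵥ u) s) (z : S) :
    c * (1 - (killed A D n *ᵥ 1) z) ≤ (A ^ n *ᵥ u) z := by
  suffices H : ∀ k ≤ n, ∀ z, c * (1 - (killed A D k *ᵥ 1) z) ≤ (A ^ k *ᵥ u) z from H n le_rfl z
  intro k hk
  induction k with
  | zero =>
    intro z
    rw [killed_zero_mulVec]
    by_cases hz : z ∈ D
    · simpa [hz] using h 0 hk z hz
    · simpa [hz] using hu z
  | succ k ih =>
    intro z
    by_cases hz : z ∈ D
    · simpa [killed_succ_mulVec, hz] using h (k + 1) hk z hz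
    · rw [killed_succ_mulVec, Set.indicator_of_mem (by simpa using hz), pow_succ',
        ← mulVec_mulVec]
      refine le_trans (le_of_eq ?_) (mulVec_mono hA (ih (Nat.le_of_succ_le hk)) z)
      rw [show (fun z => c * (1 - (killed A D k *ᵥ 1) z)) =
        fun z => ((-c) • (killed A D k *ᵥ 1)) z + c by ext; simp; ring,
        mulVec_add_const hA, mulVec_smul]
      simp
      ring

/-- Averaging against a row that dominates `ν` replaces a `ν`-part of the bound `c` by the
integral against `ν`. -/
lemma mulVec_le_of_minorized {P : Matrix S S ℝ} (hP : P ∈ rowStochastic ℝ S) {ν : S → ℝ} {z : S}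
    (hν : ∀ w, ν w ≤ P z w) {f : S → ℝ} {c : ℝ} (hf : ∀ w, f w ≤ c) :
    (P *ᵥ f) z ≤ ∑ w, ν w * f w + (1 - ∑ w, ν w) * c := by
  have h : ∑ w, (P z w - ν w) * f w ≤ ∑ w, (P z w - ν w) * c :=
    Finset.sum_le_sum fun w _ => mul_le_mul_of_nonneg_left (hf w) (sub_nonneg.2 (hν w))
  simp only [sub_mul, Finset.sum_sub_distrib, ← Finset.sum_mul,
    sum_row_of_mem_rowStochastic hP] at h
  simp only [mulVec, dotProduct]
  linarith

lemma reversible_killed {A : Matrix S S ℝ} {μ : S → ℝ} (hrev : ∀ i j, μ i * A i j = μ j * A j i)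
    (D : Set S) (n : ℕ) (i j : S) : μ i * killed A D n i j = μ j * killed A D n j i := by
  have hA : diagonal μ * A = Aᵀ * diagonal μ := by
    ext i j
    simpa [diagonal_mul, mul_diagonal, mul_comm] using hrev i j
  have hO : (offProj D)ᵀ = offProj D := by simp [offProj]
  have hc : diagonal μ * offProj D = offProj D * diagonal μ := by
    simp [offProj, diagonal_mul_diagonal, mul_comm]
  have key : diagonal μ * killed A D n = (killed A D n)ᵀ * diagonal μ := by
    induction n with
    | zero => simp [killed, hO, hc]
    | succ n ih =>
      calc diagonal μ * killed A D (n + 1)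
          = diagonal μ * killed A D n * A * offProj D := by
            rw [killed_succ]; simp only [Matrix.mul_assoc]
        _ = (killed A D n)ᵀ * (diagonal μ * A) * offProj D := by
            rw [ih]; simp only [Matrix.mul_assoc]
        _ = (killed A D n)ᵀ * Aᵀ * (diagonal μ * offProj D) := by
            rw [hA]; simp only [Matrix.mul_assoc]
        _ = (offProj D * A * killed A D n)ᵀ * diagonal μ := by
            rw [hc]; simp only [transpose_mul, hO, Matrix.mul_assoc]
        _ = (killed A D (n + 1))ᵀ * diagonal μ := by
            simp only [killed, pow_succ', Matrix.mul_assoc]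
  have := congrFun (congrFun key i) j
  simpa [diagonal_mul, mul_diagonal, mul_comm] using this

/-- By reversibility, the mean of `f` along the killed chain started from the weights `μ g` equals
the mean of `g` along the killed chain started from the weights `μ f`. -/
lemma sum_mul_occ_comm {A : Matrix S S ℝ} {μ : S → ℝ} (hrev : ∀ i j, μ i * A i j = μ j * A j i)
    (D : Set S) (f g : S → ℝ) (j : ℕ) :
    ∑ z, μ z * (g z * occ A D f j z) = ∑ z, μ z * (f z * occ A D g j z) := by
  simp only [occ, Finset.sum_apply, Finset.mul_sum]
  rw [Finset.sum_comm, Finset.sum_comm (γ := S)]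
  refine Finset.sum_congr rfl fun i _ => ?_
  simp only [mulVec, dotProduct, Finset.mul_sum]
  rw [Finset.sum_comm]
  refine Finset.sum_congr rfl fun z _ => Finset.sum_congr rfl fun w _ => ?_
  linear_combination (f z * g w) * reversible_killed hrev D i w z

lemma occ_one_le_add {A : Matrix S S ℝ} (hA : A ∈ rowStochastic ℝ S) (D : Set S) (j N : ℕ) (z : S) :
    occ A D 1 j z ≤ N + (A ^ N *ᵥ occ A D 1 j) z := by
  induction N generalizing z with
  | zero => simp
  | succ N ih =>
    have h1 : ∀ z, occ A D 1 j z ≤ (A *ᵥ occ A D 1 j) z + 1 := fun z => by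
      refine (occ_le_succ hA D (f := 1) (fun _ => zero_le_one) j z).trans ?_
      rw [occ_succ]
      by_cases hz : z ∈ D
      · have : 0 ≤ (A *ᵥ occ A D 1 j) z := Finset.sum_nonneg fun v _ =>
          mul_nonneg (nonneg_of_mem_rowStochastic hA)
            (occ_nonneg hA D (f := 1) (fun _ => zero_le_one) j v)
        simp only [Set.mem_compl_iff, hz, not_true, not_false_eq_true, Set.indicator_of_notMem]
        linarith
      · rw [Set.indicator_of_mem (by simpa using hz), Pi.add_apply, Pi.one_apply, add_comm]
    refine (ih z).trans ?_
    have h2 := mulVec_mono (pow_mem hA N) h1 z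
    rw [mulVec_add_const (pow_mem hA N), mulVec_mulVec, ← pow_succ] at h2
    push_cast
    linarith

/-- Sums along the killed chain are controlled by sums along the chain itself: if the latter stay
within `[-C, C]`, the former are at most `2 C`. This is the maximum principle. -/
lemma occ_le_of_abs_sum_le {A : Matrix S S ℝ} (hA : A ∈ rowStochastic ℝ S) (D : Set S)
    {g : S → ℝ} {C : ℝ} (hC : ∀ j z, |(∑ i ∈ Finset.range j, A ^ i *ᵥ g) z| ≤ C) (j : ℕ) (z : S) :
    occ A D g j z ≤ 2 * C := by
  suffices H : ∀ z, occ A D g j z ≤ (∑ i ∈ Finset.range j, A ^ i *ᵥ g) z + C by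
    linarith [H z, le_of_abs_le (hC j z)]
  induction j with
  | zero =>
    intro z
    have := hC 0 z
    simp only [Finset.range_zero, Finset.sum_empty, Pi.zero_apply, abs_zero] at this
    simpa [occ_zero] using this
  | succ j ih =>
    intro z
    rw [occ_succ]
    by_cases hz : z ∈ D
    · have := neg_le_of_abs_le (hC (j + 1) z)
      simp only [Set.mem_compl_iff, hz, not_true, not_false_eq_true, Set.indicator_of_notMem]
      linarith
    · have h1 := mulVec_mono hA ih z
      rw [mulVec_add_const hA] at h1
      rw [Set.indicator_of_mem (by simpa using hz), Finset.sum_range_succ', Pi.add_apply,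
        pow_zero, one_mulVec, Pi.add_apply]
      simp only [pow_succ', ← mulVec_mulVec, ← mulVec_sum]
      linarith

variable {A : Matrix S S ℝ} {μ : S → ℝ} {N : ℕ} {ε : ℝ}

lemma sum_mul_mulVec (hA : A ∈ rowStochastic ℝ S) (hrev : ∀ i j, μ i * A i j = μ j * A j i)
    (f : S → ℝ) : ∑ z, μ z * (A *ᵥ f) z = ∑ z, μ z * f z := by
  simp only [mulVec, dotProduct, Finset.mul_sum, ← mul_assoc]
  rw [Finset.sum_comm]
  simp only [hrev _ _, ← Finset.sum_mul, ← Finset.mul_sum, sum_row_of_mem_rowStochastic hA, mul_one]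

lemma sum_mul_pow_mulVec (hA : A ∈ rowStochastic ℝ S) (hrev : ∀ i j, μ i * A i j = μ j * A j i)
    (n : ℕ) (f : S → ℝ) : ∑ z, μ z * (A ^ n *ᵥ f) z = ∑ z, μ z * f z := by
  induction n generalizing f with
  | zero => simp
  | succ n ih => rw [pow_succ, ← mulVec_mulVec, ih, sum_mul_mulVec hA hrev]

/-- A chain which satisfies a Doeblin condition after `N` steps forgets its starting point, so
that the sums of a centred function remain bounded. -/
lemma abs_sum_pow_mulVec_le (hA : A ∈ rowStochastic ℝ S)
    (hrev : ∀ i j, μ i * A i j = μ j * A j i) (hμ1 : ∑ z, μ z = 1)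
    (hε : 0 < ε) (hε1 : ε ≤ 1) (hN : 0 < N) (hmin : ∀ z w, ε * μ w ≤ (A ^ N) z w)
    {g : S → ℝ} {c : ℝ} (hg : ∀ z, |g z| ≤ c) (hg0 : ∑ z, μ z * g z = 0) (j : ℕ) (z : S) :
    |(∑ i ∈ Finset.range j, A ^ i *ᵥ g) z| ≤ N * c / ε := by
  have hc : 0 ≤ c := (abs_nonneg _).trans (hg z)
  -- the trivial bound on the first `j` terms
  have triv : ∀ j z, |(∑ i ∈ Finset.range j, A ^ i *ᵥ g) z| ≤ j * c := fun j z => by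
    rw [Finset.sum_apply]
    refine (Finset.abs_sum_le_sum_abs _ _).trans ?_
    refine (Finset.sum_le_card_nsmul _ _ c fun i _ => ?_).trans (by simp)
    refine (Finset.abs_sum_le_sum_abs _ _).trans ?_
    calc ∑ w, |(A ^ i) z w * g w| ≤ ∑ w, (A ^ i) z w * c := Finset.sum_le_sum fun w _ => by
          rw [abs_mul, abs_of_nonneg (nonneg_of_mem_rowStochastic (pow_mem hA i))]
          exact mul_le_mul_of_nonneg_left (hg w) (nonneg_of_mem_rowStochastic (pow_mem hA i))
      _ = c := by rw [← Finset.sum_mul, sum_row_of_mem_rowStochastic (pow_mem hA i), one_mul]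
  induction j using Nat.strong_induction_on generalizing z with
  | _ j ih =>
    rcases lt_or_ge j N with hj | hj
    · refine (triv j z).trans ?_
      rw [le_div_iff₀ hε]
      have h1 : (j : ℝ) * c ≤ N * c :=
        mul_le_mul_of_nonneg_right (by exact_mod_cast hj.le) hc
      nlinarith [mul_nonneg (Nat.cast_nonneg (α := ℝ) j) hc]
    · obtain ⟨k, rfl⟩ := Nat.exists_eq_add_of_le hj
      set Φ := ∑ i ∈ Finset.range k, A ^ i *ᵥ g with hΦ
      have hΦ0 : ∑ w, ε * μ w * Φ w = 0 := by
        simp only [mul_assoc, ← Finset.mul_sum]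
        simp only [hΦ, Finset.sum_apply, Finset.mul_sum]
        rw [Finset.sum_comm]
        simp only [← Finset.mul_sum, sum_mul_pow_mulVec hA hrev, hg0, mul_zero,
          Finset.sum_const_zero]
      have hε' : ∑ w, ε * μ w = ε := by rw [← Finset.mul_sum, hμ1, mul_one]
      have hb : ∀ w, |Φ w| ≤ N * c / ε := fun w => ih k (by omega) w
      have up := mulVec_le_of_minorized (pow_mem hA N) (hmin z) fun w => le_of_abs_le (hb w)
      have lo := mulVec_le_of_minorized (pow_mem hA N) (hmin z) (f := -Φ) (c := N * c / ε)
        fun w => by simpa using neg_le.1 (neg_le_of_abs_le (hb w))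
      simp only [mulVec_neg, Pi.neg_apply, mul_neg, Finset.sum_neg_distrib] at lo
      rw [hΦ0, hε'] at up lo
      have e : (1 - ε) * (N * c / ε) = N * c / ε - N * c := by field_simp
      have split : (∑ i ∈ Finset.range (N + k), A ^ i *ᵥ g) z =
          (∑ i ∈ Finset.range N, A ^ i *ᵥ g) z + (A ^ N *ᵥ Φ) z := by
        rw [Finset.sum_range_add, Pi.add_apply, hΦ, mulVec_sum]
        simp only [mulVec_mulVec, pow_add]
      have t := abs_le.1 (triv N z)
      rw [split, abs_le]
      constructor <;> linarith

/-- Under a Doeblin condition, the expected time to reach `D` from an arbitrary point exceeds the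
one from `μ` conditioned on `B` by a bounded amount: the chain regenerates in `B` at rate
`ε μ(B) / N`. -/
lemma occ_one_le_sum (hA : A ∈ rowStochastic ℝ S) (hε : 0 < ε)
    (hmin : ∀ z w, ε * μ w ≤ (A ^ N) z w) (D : Set S) (B : Finset S) {a : ℝ} (ha : 0 < a)
    (haB : ∑ z ∈ B, μ z = a) (j : ℕ) (z : S) :
    occ A D 1 j z ≤ N / (ε * a) + (∑ w ∈ B, μ w * occ A D 1 j w) / a := by
  have : Nonempty S := ⟨z⟩
  obtain ⟨z₀, hz₀⟩ := Finite.exists_max (occ A D 1 j)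
  refine (hz₀ z).trans ?_
  classical
  have h := mulVec_le_of_minorized (pow_mem hA N) (z := z₀) (f := occ A D 1 j)
    (ν := fun w => if w ∈ B then ε * μ w else 0) (fun w => by
      split_ifs
      · exact hmin z₀ w
      · exact nonneg_of_mem_rowStochastic (pow_mem hA N)) hz₀
  simp only [ite_mul, zero_mul, Finset.sum_ite_mem, Finset.univ_inter, ← Finset.mul_sum, haB,
    mul_assoc] at h
  have h' := occ_one_le_add hA D j N z₀
  have e : N / (ε * a) + (∑ w ∈ B, μ w * occ A D 1 j w) / a =
      (N + ε * ∑ w ∈ B, μ w * occ A D 1 j w) / (ε * a) := by field_simp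
  rw [e, le_div_iff₀ (by positivity)]
  linarith

/-- Comparison of the expected time to reach `D` with the expected time spent in `B` before that,
started from `μ`. -/
lemma occ_one_le_stationary (hA : A ∈ rowStochastic ℝ S)
    (hrev : ∀ i j, μ i * A i j = μ j * A j i) (hε : 0 < ε)
    (hmin : ∀ z w, ε * μ w ≤ (A ^ N) z w) (D : Set S) (B : Finset S) {a : ℝ} (ha : 0 < a)
    (haB : ∑ z ∈ B, μ z = a) (j : ℕ) (z : S) :
    occ A D 1 j z ≤
      N / (ε * a) + (∑ w, μ w * occ A D ((B : Set S).indicator 1) j w) / a := by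
  refine (occ_one_le_sum hA hε hmin D B ha haB j z).trans (le_of_eq ?_)
  have h := sum_mul_occ_comm hrev D 1 ((B : Set S).indicator 1) j
  simp only [Pi.one_apply, one_mul] at h
  rw [← h]
  classical
  simp [Set.indicator_apply, Finset.sum_ite_mem]

/-- Comparison of the expected time to reach `D` with the expected time spent in `B` before that,
started from `μ` conditioned on `B`. -/
lemma occ_one_le_conditioned (hA : A ∈ rowStochastic ℝ S)
    (hrev : ∀ i j, μ i * A i j = μ j * A j i) (hμ : ∀ z, 0 ≤ μ z) (hμ1 : ∑ z, μ z = 1)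
    (hε : 0 < ε) (hε1 : ε ≤ 1) (hN : 0 < N)
    (hmin : ∀ z w, ε * μ w ≤ (A ^ N) z w) (D : Set S) (B : Finset S) {a : ℝ} (ha : 0 < a)
    (haB : ∑ z ∈ B, μ z = a) (j : ℕ) (z : S) :
    occ A D 1 j z ≤ 3 * (N / (ε * a)) +
      (∑ w ∈ B, μ w * occ A D ((B : Set S).indicator 1) j w) / a / a := by
  have ha1 : a ≤ 1 := by
    rw [← haB, ← hμ1]
    exact Finset.sum_le_sum_of_subset_of_nonneg (Finset.subset_univ _) fun w _ _ => hμ w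
  have hinv : 1 ≤ a⁻¹ := (one_le_inv₀ ha).2 ha1
  -- the centred function `1 - 1_B / a`
  set g : S → ℝ := 1 - a⁻¹ • (B : Set S).indicator 1 with hgdef
  have hg : ∀ z, |g z| ≤ a⁻¹ := fun z => by
    by_cases hz : z ∈ B
    · simp only [hgdef, Pi.sub_apply, Pi.one_apply, Pi.smul_apply, Finset.mem_coe, hz,
        Set.indicator_of_mem, smul_eq_mul, mul_one]
      rw [abs_le]; constructor <;> linarith
    · simpa [hgdef, hz] using hinv
  have hg0 : ∑ z, μ z * g z = 0 := by
    classical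
    simp only [hgdef, Pi.sub_apply, Pi.one_apply, Pi.smul_apply, Set.indicator_apply,
      Finset.mem_coe, smul_eq_mul, mul_ite, mul_one, mul_zero, mul_sub, Finset.sum_sub_distrib,
      hμ1, Finset.sum_ite_mem, Finset.univ_inter, ← Finset.sum_mul, haB]
    field_simp
    simp
  have hpoisson : ∀ w, occ A D 1 j w ≤
      2 * (N / (ε * a)) + occ A D ((B : Set S).indicator 1) j w / a := fun w => by
    have h := occ_le_of_abs_sum_le hA D
      (abs_sum_pow_mulVec_le hA hrev hμ1 hε hε1 hN hmin hg hg0) j w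
    have e : occ A D g j w =
        occ A D 1 j w - a⁻¹ * occ A D ((B : Set S).indicator 1) j w := by
      simp [occ, hgdef, mulVec_sub, mulVec_smul, Finset.mul_sum]
    have e2 : N * a⁻¹ / ε = N / (ε * a) := by field_simp
    rw [e, e2] at h
    rw [div_eq_inv_mul (occ _ _ _ _ _)]
    linarith
  refine (occ_one_le_sum hA hε hmin D B ha haB j z).trans ?_
  have hsum : ∑ w ∈ B, μ w * occ A D 1 j w ≤ a * (2 * (N / (ε * a))) +
      (∑ w ∈ B, μ w * occ A D ((B : Set S).indicator 1) j w) / a := by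
    rw [← haB, Finset.sum_mul, Finset.sum_div, ← Finset.sum_add_distrib, haB]
    refine Finset.sum_le_sum fun w _ => ?_
    rw [mul_div_assoc, ← mul_add]
    exact mul_le_mul_of_nonneg_left (hpoisson w) (hμ w)
  have := div_le_div_of_nonneg_right hsum ha.le
  rw [add_div, mul_div_cancel_left₀ _ ha.ne'] at this
  linarith

end Discrete

/-! ### Markov processes sampled on a grid -/

section Grid

open Matrix

variable {S Ω : Type*} [Fintype S] [DecidableEq S] [MeasurableSpace Ω]

/-- A right-continuous Markov process with transition matrices `p t`, described as in
`CTMC.IsMarkovChain` but without reference to a generator; this covers a chain as well as a pair of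
independent chains. -/
structure IsMarkovProcess (p : ℝ≥0 → Matrix S S ℝ) (P : S → Measure Ω) (Z : ℝ≥0 → Ω → S) :
    Prop where
  stochastic : ∀ t, p t ∈ rowStochastic ℝ S
  isProbabilityMeasure : ∀ x, IsProbabilityMeasure (P x)
  measurableSet_eq : ∀ t v, MeasurableSet {ω | Z t ω = v}
  rightContinuous : ∀ ω t, ∀ᶠ u in 𝓝[≥] t, Z u ω = Z t ω
  start : ∀ x, ∀ᵐ ω ∂(P x), Z 0 ω = x
  markov : ∀ (x : S) (k : ℕ) (t : ℕ → ℝ≥0) (v : ℕ → S), Monotone t →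
    P x {ω | ∀ i ≤ k + 1, Z (t i) ω = v i} =
      P x {ω | ∀ i ≤ k, Z (t i) ω = v i} * ENNReal.ofReal (p (t (k + 1) - t k) (v k) (v (k + 1)))

variable {p : ℝ≥0 → Matrix S S ℝ} {P : S → Measure Ω} {Z : ℝ≥0 → Ω → S}

namespace IsMarkovProcess

lemma measurableSet_mem (hZ : IsMarkovProcess p P Z) (t : ℝ≥0) (B : Set S) :
    MeasurableSet {ω | Z t ω ∈ B} := by
  have : {ω | Z t ω ∈ B} = ⋃ v ∈ B, {ω | Z t ω = v} := by ext; simp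
  rw [this]
  exact B.toFinite.measurableSet_biUnion fun v _ => hZ.measurableSet_eq t v

/-- The Markov property for an arbitrary event `G` of the past that determines the present state
`a`. -/
lemma measure_past_inter (hZ : IsMarkovProcess p P Z) (x : S) (k : ℕ) {t : ℕ → ℝ≥0}
    (ht : Monotone t) (G : Finset (Fin (k + 1) → S)) {a : S} (hG : ∀ v ∈ G, v (Fin.last k) = a)
    (b : S) :
    P x ({ω | (fun i : Fin (k + 1) => Z (t i) ω) ∈ G} ∩ {ω | Z (t (k + 1)) ω = b}) =
      P x {ω | (fun i : Fin (k + 1) => Z (t i) ω) ∈ G} *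
        ENNReal.ofReal (p (t (k + 1) - t k) a b) := by
  set f : Ω → (Fin (k + 1) → S) := fun ω i => Z (t i) ω with hf
  have hmeas : ∀ v : Fin (k + 1) → S, MeasurableSet (f ⁻¹' {v}) := fun v => by
    have : f ⁻¹' {v} = ⋂ i : Fin (k + 1), {ω | Z (t i) ω = v i} := by
      ext ω; simp [hf, funext_iff]
    rw [this]
    exact MeasurableSet.iInter fun i => hZ.measurableSet_eq _ _
  have hpre : {ω | f ω ∈ G} = f ⁻¹' (G : Set (Fin (k + 1) → S)) := rfl
  rw [hpre, ← Measure.restrict_apply' (hZ.measurableSet_eq _ _),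
    ← sum_measure_preimage_singleton G fun v _ => hmeas v,
    ← sum_measure_preimage_singleton G fun v _ => hmeas v, Finset.sum_mul]
  refine Finset.sum_congr rfl fun v hv => ?_
  rw [Measure.restrict_apply' (hZ.measurableSet_eq _ _)]
  set w : ℕ → S := fun i => if h : i < k + 1 then v ⟨i, h⟩ else b with hw
  have h1 : f ⁻¹' {v} = {ω | ∀ i ≤ k, Z (t i) ω = w i} := by
    ext ω
    simp only [Set.mem_preimage, Set.mem_singleton_iff, hf, funext_iff, Set.mem_ofPred_eq]
    constructor
    · intro h i hi
      have hi' : i < k + 1 := Nat.lt_succ_of_le hi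
      simpa only [hw, dif_pos hi'] using h ⟨i, hi'⟩
    · intro h i
      simpa only [hw, dif_pos i.2] using h i (Nat.le_of_lt_succ i.2)
  have h2 : f ⁻¹' {v} ∩ {ω | Z (t (k + 1)) ω = b} = {ω | ∀ i ≤ k + 1, Z (t i) ω = w i} := by
    rw [h1]
    ext ω
    simp only [Set.mem_inter_iff, Set.mem_ofPred_eq, Nat.le_succ_iff, or_imp, forall_and,
      forall_eq]
    simp [hw]
  have hk : w k = a := by
    rw [← hG v hv]
    simp [hw, Fin.last]
  rw [h2, h1, hZ.markov x k t w ht, hk]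
  simp [hw]

lemma measure_zero (hZ : IsMarkovProcess p P Z) (x w : S) :
    P x {ω | Z 0 ω = w} = if x = w then 1 else 0 := by
  have := hZ.isProbabilityMeasure x
  split_ifs with h
  · subst h
    exact (prob_compl_eq_zero_iff (hZ.measurableSet_eq 0 x)).1 (hZ.start x)
  · refine measure_mono_null ?_ (hZ.start x)
    rintro ω rfl h'
    exact h h'.symm

end IsMarkovProcess

lemma killed_nonneg {A : Matrix S S ℝ} (hA : A ∈ rowStochastic ℝ S) (D : Set S) (j : ℕ) (z w : S) :
    0 ≤ killed A D j z w := by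
  have h := killed_mulVec_nonneg hA D (f := Pi.single w 1)
    (fun v => by by_cases h : v = w <;> simp [h]) j z
  simpa using h

namespace IsMarkovProcess

/-- The process sampled at the multiples of `δ` and killed on `D` is the killed discrete-time
chain. -/
lemma measure_grid (hZ : IsMarkovProcess p P Z) (D : Set S) (δ : ℝ≥0) (j : ℕ) (x w : S) :
    P x {ω | (∀ i ≤ j, Z (i * δ) ω ∉ D) ∧ Z (j * δ) ω = w} =
      ENNReal.ofReal (killed (p δ) D j x w) := by
  classical
  induction j generalizing w with
  | zero =>
    have e : killed (p δ) D 0 x w = if x = w ∧ w ∉ D then 1 else 0 := by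
      by_cases h : x = w
      · subst h
        simp [killed, offProj, Set.indicator_apply]
      · simp [killed, offProj, h]
    by_cases hw : w ∈ D
    · have : {ω | (∀ i ≤ 0, Z ((i : ℕ) * δ) ω ∉ D) ∧ Z ((0 : ℕ) * δ) ω = w} = ∅ := by
        ext ω
        simp only [Set.mem_ofPred_eq, Set.mem_empty_iff_false, iff_false, not_and]
        rintro h rfl
        exact h 0 le_rfl hw
      rw [this, e]
      simp [hw]
    · have : {ω | (∀ i ≤ 0, Z ((i : ℕ) * δ) ω ∉ D) ∧ Z ((0 : ℕ) * δ) ω = w} =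
          {ω | Z 0 ω = w} := by
        ext ω
        simp only [Set.mem_ofPred_eq, Nat.le_zero, forall_eq, Nat.cast_zero, zero_mul,
          and_iff_right_iff_imp]
        rintro rfl
        exact hw
      rw [this, e, hZ.measure_zero]
      by_cases h : x = w <;> simp [h, hw]
  | succ j ih =>
    have ekill : killed (p δ) D (j + 1) x w =
        if w ∈ D then 0 else ∑ v, killed (p δ) D j x v * p δ v w := by
      rw [killed_succ, offProj, mul_diagonal, Matrix.mul_apply]
      by_cases hw : w ∈ D <;> simp [hw]
    rw [ekill]
    split_ifs with hw
    · have : {ω | (∀ i ≤ j + 1, Z ((i : ℕ) * δ) ω ∉ D) ∧ Z ((j + 1 : ℕ) * δ) ω = w} = ∅ := by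
        ext ω
        simp only [Set.mem_ofPred_eq, Set.mem_empty_iff_false, iff_false, not_and]
        rintro h rfl
        exact h (j + 1) le_rfl hw
      rw [this, measure_empty, ENNReal.ofReal_zero]
    · set t : ℕ → ℝ≥0 := fun i => i * δ with ht
      have htm : Monotone t := fun i k h => by
        simp only [ht]; gcongr
      have hδ : t (j + 1) - t j = δ := by
        simp only [ht, Nat.cast_add, Nat.cast_one, add_mul, one_mul, add_tsub_cancel_left]
      -- split according to the position at time `j δ`
      have hsplit : P x {ω | (∀ i ≤ j + 1, Z (t i) ω ∉ D) ∧ Z (t (j + 1)) ω = w} =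
          ∑ v, P x ({ω | (∀ i ≤ j, Z (t i) ω ∉ D) ∧ Z (t j) ω = v} ∩
            {ω | Z (t (j + 1)) ω = w}) := by
        have e : {ω | (∀ i ≤ j + 1, Z (t i) ω ∉ D) ∧ Z (t (j + 1)) ω = w} =
            {ω | ∀ i ≤ j, Z (t i) ω ∉ D} ∩ {ω | Z (t (j + 1)) ω = w} := by
          ext ω
          simp only [Set.mem_ofPred_eq, Set.mem_inter_iff, Nat.le_succ_iff, or_imp, forall_and,
            forall_eq]
          constructor
          · rintro ⟨⟨h1, _⟩, h2⟩
            exact ⟨h1, h2⟩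
          · rintro ⟨h1, h2⟩
            exact ⟨⟨h1, h2 ▸ hw⟩, h2⟩
        have hM : MeasurableSet {ω | ∀ i ≤ j, Z (t i) ω ∉ D} := by
          simp only [Set.ofPred_forall]
          exact MeasurableSet.iInter fun i => MeasurableSet.iInter fun _ =>
            hZ.measurableSet_mem (t i) Dᶜ
        rw [e]
        set M := {ω | ∀ i ≤ j, Z (t i) ω ∉ D} ∩ {ω | Z (t (j + 1)) ω = w} with hMdef
        have hMm : MeasurableSet M := hM.inter (hZ.measurableSet_eq _ _)
        have hu := sum_measure_preimage_singleton (μ := (P x).restrict M) Finset.univ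
          (f := Z (t j)) fun v _ => hZ.measurableSet_eq (t j) v
        rw [Finset.coe_univ, Set.preimage_univ, Measure.restrict_apply_univ] at hu
        rw [← hu]
        refine Finset.sum_congr rfl fun v _ => ?_
        rw [Measure.restrict_apply' hMm]
        congr 1
        ext ω
        simp only [hMdef, Set.mem_inter_iff, Set.mem_preimage, Set.mem_singleton_iff,
          Set.mem_ofPred_eq]
        tauto
      have hrw : {ω | (∀ i ≤ j + 1, Z ((i : ℕ) * δ) ω ∉ D) ∧ Z ((j + 1 : ℕ) * δ) ω = w} =
          {ω | (∀ i ≤ j + 1, Z (t i) ω ∉ D) ∧ Z (t (j + 1)) ω = w} := rfl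
      rw [hrw, hsplit, ENNReal.ofReal_sum_of_nonneg fun v _ => mul_nonneg
        (killed_nonneg (hZ.stochastic δ) D j x v) (nonneg_of_mem_rowStochastic (hZ.stochastic δ))]
      refine Finset.sum_congr rfl fun v _ => ?_
      rw [ENNReal.ofReal_mul (killed_nonneg (hZ.stochastic δ) D j x v), ← ih v]
      have h := hZ.measure_past_inter x j htm
        (Finset.univ.filter fun u : Fin (j + 1) → S => (∀ i, u i ∉ D) ∧ u (Fin.last j) = v)
        (a := v) (fun u hu => (Finset.mem_filter.1 hu).2.2) w
      have hset : {ω | (fun i : Fin (j + 1) => Z (t i) ω) ∈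
          (Finset.univ.filter fun u : Fin (j + 1) → S => (∀ i, u i ∉ D) ∧ u (Fin.last j) = v)} =
          {ω | (∀ i ≤ j, Z (t i) ω ∉ D) ∧ Z (t j) ω = v} := by
        ext ω
        simp only [Set.mem_ofPred_eq, Finset.mem_filter, Finset.mem_univ, true_and, Fin.val_last]
        refine and_congr_left fun _ => ⟨fun h i hi => h ⟨i, Nat.lt_succ_of_le hi⟩, fun h i =>
          h i (Nat.le_of_lt_succ i.2)⟩
      rw [hset, hδ] at h
      exact h

lemma measure_grid_mem (hZ : IsMarkovProcess p P Z) (D : Set S) (B : Finset S) (δ : ℝ≥0) (j : ℕ)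
    (x : S) :
    P x {ω | (∀ i ≤ j, Z (i * δ) ω ∉ D) ∧ Z (j * δ) ω ∈ B} =
      ENNReal.ofReal ((killed (p δ) D j *ᵥ (B : Set S).indicator 1) x) := by
  classical
  have hM : MeasurableSet {ω | ∀ i ≤ j, Z ((i : ℕ) * δ) ω ∉ D} := by
    simp only [Set.ofPred_forall]
    exact MeasurableSet.iInter fun i => MeasurableSet.iInter fun _ =>
      hZ.measurableSet_mem _ Dᶜ
  have hu := sum_measure_preimage_singleton
    (μ := (P x).restrict {ω | ∀ i ≤ j, Z ((i : ℕ) * δ) ω ∉ D}) B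
    (f := Z (j * δ)) fun v _ => hZ.measurableSet_eq (j * δ) v
  have e : {ω | (∀ i ≤ j, Z ((i : ℕ) * δ) ω ∉ D) ∧ Z (j * δ) ω ∈ B} =
      Z (j * δ) ⁻¹' B ∩ {ω | ∀ i ≤ j, Z ((i : ℕ) * δ) ω ∉ D} := by
    ext ω; simp [and_comm]
  rw [e, ← Measure.restrict_apply' hM, ← hu]
  have e2 : (killed (p δ) D j *ᵥ (B : Set S).indicator 1) x = ∑ w ∈ B, killed (p δ) D j x w := by
    simp [mulVec, dotProduct, Set.indicator_apply, Finset.sum_ite_mem]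
  rw [e2, ENNReal.ofReal_sum_of_nonneg fun v _ => killed_nonneg (hZ.stochastic δ) D j x v]
  refine Finset.sum_congr rfl fun w _ => ?_
  rw [← hZ.measure_grid, Measure.restrict_apply' hM]
  congr 1
  ext ω
  simp [and_comm]

lemma measure_grid_univ (hZ : IsMarkovProcess p P Z) (D : Set S) (δ : ℝ≥0) (j : ℕ) (x : S) :
    P x {ω | ∀ i ≤ j, Z (i * δ) ω ∉ D} = ENNReal.ofReal ((killed (p δ) D j *ᵥ 1) x) := by
  simpa using hZ.measure_grid_mem D Finset.univ δ j x

end IsMarkovProcess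

end Grid

/-! ### Transition matrices of a reversible chain -/

/-- The invariant vector of an irreducible reversible chain charges every state. -/
lemma IsInvariant.pos {V : Type*} [Fintype V] {Q : Matrix V V ℝ} {π : V → ℝ}
    (hπ : IsInvariant Q π) (hirr : IsIrreducible Q)
    (hrev : IsReversible Q π) (i : V) : 0 < π i := by
  by_contra hi
  have hi0 : π i = 0 := le_antisymm (not_lt.1 hi) (hπ.nonneg i)
  have h : ∀ j, π j = 0 := fun j => by
    induction hirr j i using Relation.ReflTransGen.head_induction_on with
    | refl => exact hi0
    | @head a b hab _ ih =>
      have h0 : π a * Q a b = 0 := (hrev a b).trans (mul_eq_zero_of_left ih _)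
      exact (mul_eq_zero.1 h0).resolve_right hab.ne'
  simpa [h] using hπ.sum_one

section Trans

open Matrix

variable {V Ω : Type*} [Fintype V] [DecidableEq V] [MeasurableSpace Ω]
  {Q : Matrix V V ℝ} {π : V → ℝ} {P : V → Measure Ω} {X : ℝ≥0 → Ω → V}

lemma semiconjBy_exp {J M N : Matrix V V ℝ} (h : SemiconjBy J M N) :
    SemiconjBy J (NormedSpace.exp M) (NormedSpace.exp N) := by
  let _ := Matrix.linftyOpNormedRing (n := V) (α := ℝ)
  let _ := Matrix.linftyOpNormedAlgebra (n := V) (α := ℝ) (R := ℝ)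
  let _ := Matrix.linftyOpNormedAlgebra (n := V) (α := ℝ) (R := ℚ)
  have : CompleteSpace (Matrix V V ℝ) := FiniteDimensional.complete ℝ _
  exact SemiconjBy.exp_right h

lemma trans_zero : trans Q 0 = 1 := by simp [trans]

lemma trans_add (s t : ℝ≥0) : trans Q (s + t) = trans Q s * trans Q t := by
  rw [trans, NNReal.coe_add, add_smul, Matrix.exp_add_of_commute]
  · rfl
  · exact ((Commute.refl Q).smul_left _).smul_right _

lemma trans_nat_mul (δ : ℝ≥0) (k : ℕ) : trans Q (k * δ) = trans Q δ ^ k := by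
  induction k with
  | zero => simp [trans_zero]
  | succ k ih => rw [Nat.cast_succ, add_mul, one_mul, trans_add, ih, pow_succ]

lemma sum_trans (hQ : IsGenerator Q) (t : ℝ≥0) (i : V) : ∑ j, trans Q t i j = 1 := by
  have h : SemiconjBy (Matrix.of fun _ _ => 1 : Matrix V V ℝ) 0 ((t : ℝ) • Q) := by
    have : ((t : ℝ) • Q) * (Matrix.of fun _ _ => 1 : Matrix V V ℝ) = 0 := by
      ext i j
      simp [Matrix.mul_apply, ← Finset.mul_sum, hQ.row_sum]
    simp [SemiconjBy, this]
  have h2 := congrFun (congrFun (semiconjBy_exp h).eq i) i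
  simpa [Matrix.mul_apply, trans, Matrix.one_apply] using h2.symm

/-- The entries of the transition matrices are nonnegative: each row sums to one, and so do the
positive parts of its entries, which are probabilities. -/
lemma trans_mem_rowStochastic (hQ : IsGenerator Q) (hX : IsMarkovChain Q P X) (t : ℝ≥0) :
    trans Q t ∈ rowStochastic ℝ V := by
  refine mem_rowStochastic_iff_sum.2 ⟨fun i j => ?_, sum_trans hQ t⟩
  have hprob := hX.isProbabilityMeasure i
  have hstart : P i {ω | X 0 ω = i} = 1 :=
    (prob_compl_eq_zero_iff (hX.measurableSet_eq 0 i)).1 (hX.start i)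
  have hlaw : ∀ j, ENNReal.ofReal (trans Q t i j) = P i ({ω | X t ω = j} ∩ {ω | X 0 ω = i}) := by
    intro j
    have h := hX.markov i 0 (fun n => n * t) (fun n => if n = 0 then i else j)
      (fun a b hab => by dsimp only; gcongr)
    simp only [Nat.le_zero, forall_eq, Nat.cast_zero, zero_mul, if_true, hstart, one_mul,
      zero_add, Nat.cast_one, tsub_zero, one_ne_zero, if_false] at h
    rw [← h]
    congr 1
    ext ω
    simp only [Set.mem_ofPred_eq, Set.mem_inter_iff, Nat.le_succ_iff, or_imp, forall_and,
      Nat.le_zero, forall_eq]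
    simp [and_comm]
  have hsum : ∑ j, ENNReal.ofReal (trans Q t i j) = 1 := by
    have hu := sum_measure_preimage_singleton (μ := (P i).restrict {ω | X 0 ω = i}) Finset.univ
      (f := X t) fun v _ => hX.measurableSet_eq t v
    rw [Finset.coe_univ, Set.preimage_univ, Measure.restrict_apply_univ, hstart] at hu
    rw [← hu]
    refine Finset.sum_congr rfl fun j _ => ?_
    rw [hlaw, Measure.restrict_apply' (hX.measurableSet_eq 0 i)]
    rfl
  have hmax : ∑ j, max (trans Q t i j) 0 = 1 := by
    have := congrArg ENNReal.toReal hsum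
    rw [ENNReal.toReal_sum fun _ _ => ENNReal.ofReal_ne_top] at this
    simpa [ENNReal.toReal_ofReal'] using this
  have hzero : ∑ j, (max (trans Q t i j) 0 - trans Q t i j) = 0 := by
    rw [Finset.sum_sub_distrib, hmax, sum_trans hQ, sub_self]
  have := (Finset.sum_eq_zero_iff_of_nonneg fun j _ => sub_nonneg.2 (le_max_left _ _)).1 hzero j
    (Finset.mem_univ j)
  linarith [le_max_right (trans Q t i j) 0]

lemma IsReversible.trans (hrev : IsReversible Q π) (t : ℝ≥0) (i j : V) :
    π i * trans Q t i j = π j * trans Q t j i := by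
  have h : SemiconjBy (diagonal π) ((t : ℝ) • Q) ((t : ℝ) • Q)ᵀ := by
    ext i j
    simp only [diagonal_mul, mul_diagonal, transpose_apply, Matrix.smul_apply, smul_eq_mul]
    linear_combination (t : ℝ) * hrev i j
  have h2 := congrFun (congrFun (semiconjBy_exp h).eq i) j
  rw [Matrix.exp_transpose, diagonal_mul, mul_diagonal, transpose_apply, mul_comm (_ : ℝ) (π j)]
    at h2
  exact h2

/-- The return probabilities of a reversible chain never drop below their limit. -/
lemma IsReversible.le_trans_self (hrev : IsReversible Q π) (hQ : IsGenerator Q)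
    (hpos : ∀ i, 0 < π i) (hsum : ∑ i, π i = 1) (t : ℝ≥0) (s : V) : π s ≤ CTMC.trans Q t s s := by
  have ht : t = t / 2 + t / 2 := (add_halves t).symm
  rw [ht, trans_add, Matrix.mul_apply]
  have h := Finset.sq_sum_div_le_sum_sq_div Finset.univ (CTMC.trans Q (t / 2) s)
    (g := π) fun i _ => hpos i
  rw [sum_trans hQ, hsum] at h
  have h2 : ∑ z, CTMC.trans Q (t / 2) s z * CTMC.trans Q (t / 2) z s =
      π s * ∑ z, CTMC.trans Q (t / 2) s z ^ 2 / π z := by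
    rw [Finset.mul_sum]
    refine Finset.sum_congr rfl fun z _ => ?_
    have := hrev.trans (t / 2) s z
    field_simp [(hpos z).ne']
    linear_combination (-CTMC.trans Q (t / 2) s z) * this
  rw [h2]
  exact le_mul_of_one_le_right (hpos s).le (by simpa using h)

lemma IsMarkovChain.isMarkovProcess (hX : IsMarkovChain Q P X) (hQ : IsGenerator Q) :
    IsMarkovProcess (CTMC.trans Q) P X where
  stochastic := trans_mem_rowStochastic hQ hX
  isProbabilityMeasure := hX.isProbabilityMeasure
  measurableSet_eq := hX.measurableSet_eq
  rightContinuous := hX.rightContinuous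
  start := hX.start
  markov := hX.markov

/-- Two independent copies of a chain form a Markov process with transition matrices
`p t ⊗ p t`. -/
lemma IsMarkovChain.isMarkovProcess_pair (hX : IsMarkovChain Q P X) (hQ : IsGenerator Q) :
    IsMarkovProcess (fun t => kroneckerMap (· * ·) (CTMC.trans Q t) (CTMC.trans Q t))
      (fun z : V × V => (P z.1).prod (P z.2)) (pair X) where
  stochastic t := by
    have h := trans_mem_rowStochastic hQ hX t
    refine mem_rowStochastic_iff_sum.2 ⟨fun i j => ?_, fun i => ?_⟩
    · exact mul_nonneg (nonneg_of_mem_rowStochastic h) (nonneg_of_mem_rowStochastic h)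
    · simp only [kroneckerMap_apply, Fintype.sum_prod_type, ← Finset.mul_sum,
        sum_row_of_mem_rowStochastic h, mul_one]
  isProbabilityMeasure z := by
    have := hX.isProbabilityMeasure z.1
    have := hX.isProbabilityMeasure z.2
    infer_instance
  measurableSet_eq t v := by
    have : {ω | pair X t ω = v} = {ω | X t ω = v.1} ×ˢ {ω | X t ω = v.2} := by
      ext ω; simp [pair, Prod.ext_iff]
    rw [this]
    exact (hX.measurableSet_eq t v.1).prod (hX.measurableSet_eq t v.2)
  rightContinuous ω t := by
    filter_upwards [hX.rightContinuous ω.1 t, hX.rightContinuous ω.2 t] with u h1 h2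
    simp [pair, h1, h2]
  start z := by
    have := hX.isProbabilityMeasure z.1
    have := hX.isProbabilityMeasure z.2
    have h1 := (Measure.quasiMeasurePreserving_fst (μ := P z.1) (ν := P z.2)).ae (hX.start z.1)
    have h2 := (Measure.quasiMeasurePreserving_snd (μ := P z.1) (ν := P z.2)).ae (hX.start z.2)
    filter_upwards [h1, h2] with ω h1 h2
    exact Prod.ext h1 h2
  markov z k t v ht := by
    have := hX.isProbabilityMeasure z.1
    have := hX.isProbabilityMeasure z.2
    have hprod : ∀ k, {ω : Ω × Ω | ∀ i ≤ k, pair X (t i) ω = v i} =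
        {ω | ∀ i ≤ k, X (t i) ω = (v i).1} ×ˢ {ω | ∀ i ≤ k, X (t i) ω = (v i).2} := fun k => by
      ext ω
      simp only [pair, Prod.ext_iff, Set.mem_ofPred_eq, Set.mem_prod]
      exact ⟨fun h => ⟨fun i hi => (h i hi).1, fun i hi => (h i hi).2⟩,
        fun h i hi => ⟨h.1 i hi, h.2 i hi⟩⟩
    rw [hprod, hprod, Measure.prod_prod, Measure.prod_prod,
      hX.markov z.1 k t (fun i => (v i).1) ht, hX.markov z.2 k t (fun i => (v i).2) ht,
      kroneckerMap_apply, ENNReal.ofReal_mul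
        (nonneg_of_mem_rowStochastic (trans_mem_rowStochastic hQ hX _))]
    ring

end Trans

/-! ### Right-continuous paths and their values on a grid -/

section Paths

open Filter

variable {Ω S : Type*} {Z : ℝ≥0 → Ω → S} {ω : Ω}

/-- If `D` is visited before time `t`, then so it is at a multiple of `δ`, for all small `δ`. -/
lemma eventually_exists_nat_mul_mem (hZ : ∀ t, ∀ᶠ u in 𝓝[≥] t, Z u ω = Z t ω) {D : Set S}
    {t : ℝ≥0} (h : hitTime Z D ω < t) :
    ∀ᶠ δ in 𝓝[>] (0 : ℝ≥0), ∃ i : ℕ, i * δ < t ∧ Z (i * δ) ω ∈ D := by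
  simp only [hitTime, iInf_lt_iff, ENNReal.coe_lt_coe] at h
  obtain ⟨r, hr, hrt⟩ := h
  have hev : ∀ᶠ u in 𝓝[≥] r, Z u ω = Z r ω ∧ u < t :=
    (hZ r).and (nhdsWithin_le_nhds (Iio_mem_nhds hrt))
  obtain ⟨v, hv, hsub⟩ := (mem_nhdsGE_iff_exists_Ico_subset).1 hev
  have hv' : r < v := hv
  filter_upwards [Ioo_mem_nhdsGT (tsub_pos_of_lt hv')] with δ hδ
  have hδ0 : 0 < δ := hδ.1
  refine ⟨⌈r / δ⌉₊, ?_⟩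
  have h1 : r ≤ ⌈r / δ⌉₊ * δ := by
    rw [← div_le_iff₀ hδ0]; exact Nat.le_ceil _
  have h2 : ⌈r / δ⌉₊ * δ < v := by
    have : (⌈r / δ⌉₊ : ℝ≥0) < r / δ + 1 := Nat.ceil_lt_add_one zero_le
    calc ⌈r / δ⌉₊ * δ < (r / δ + 1) * δ := by gcongr
      _ = r + δ := by rw [add_mul, div_mul_cancel₀ _ hδ0.ne', one_mul]
      _ ≤ r + (v - r) := by gcongr; exact hδ.2.le
      _ = v := add_tsub_cancel_of_le hv'.le
  obtain ⟨h3, h4⟩ := hsub ⟨h1, h2⟩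
  exact ⟨h4, h3 ▸ hr⟩

lemma hitTime_le_of_mem {D : Set S} {t : ℝ≥0} (h : Z t ω ∈ D) : hitTime Z D ω ≤ t :=
  iInf₂_le t h

lemma measurable_hitTime [MeasurableSpace Ω] (hZ : ∀ ω t, ∀ᶠ u in 𝓝[≥] t, Z u ω = Z t ω) {D : Set S}
    (hD : ∀ t, MeasurableSet {ω | Z t ω ∈ D}) : Measurable (hitTime Z D) := by
  refine measurable_of_Iio fun c => ?_
  -- by right-continuity it is enough to look at the countably many times `i / (n + 1)`
  have : hitTime Z D ⁻¹' Set.Iio c = ⋃ (n : ℕ) (i : ℕ)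
      (_ : ((i * (n + 1 : ℝ≥0)⁻¹ : ℝ≥0) : ℝ≥0∞) < c), {ω | Z (i * (n + 1 : ℝ≥0)⁻¹) ω ∈ D} := by
    ext ω
    simp only [Set.mem_preimage, Set.mem_Iio, Set.mem_iUnion, Set.mem_ofPred_eq, exists_prop]
    constructor
    · intro h
      obtain ⟨t, ht1, ht2⟩ := ENNReal.lt_iff_exists_nnreal_btwn.1 h
      have hlim : Tendsto (fun n : ℕ => (n + 1 : ℝ≥0)⁻¹) atTop (𝓝[>] 0) := by
        refine tendsto_nhdsWithin_iff.2 ⟨?_, Eventually.of_forall fun n => by simp⟩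
        simpa using tendsto_one_div_add_atTop_nhds_zero_nat (𝕜 := ℝ≥0)
      obtain ⟨n, i, hi, hm⟩ := (hlim.eventually (eventually_exists_nat_mul_mem (hZ ω) ht1)).exists
      exact ⟨n, i, (ENNReal.coe_lt_coe.2 hi).trans ht2, hm⟩
    · rintro ⟨n, i, hlt, hm⟩
      exact (hitTime_le_of_mem hm).trans_lt hlt
  rw [this]
  exact MeasurableSet.iUnion fun n => MeasurableSet.iUnion fun i => MeasurableSet.iUnion fun _ =>
    hD _

/-- The event that the path avoids `D` at the times `0, δ, …, i δ` and is in `B` at the last. -/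
def gridAlive (Z : ℝ≥0 → Ω → S) (D B : Set S) (δ : ℝ≥0) (i : ℕ) : Set Ω :=
  {ω | (∀ l ≤ i, Z (l * δ) ω ∉ D) ∧ Z (i * δ) ω ∈ B}

/-- The time spent in `B` before `D` is reached, as seen on the times `0, δ, …, (j - 1) δ`. -/
noncomputable def gridOcc (Z : ℝ≥0 → Ω → S) (D B : Set S) (δ : ℝ≥0) (j : ℕ) (ω : Ω) : ℝ≥0∞ :=
  ∑ i ∈ Finset.range j, δ * (gridAlive Z D B δ i).indicator 1 ω

/-- The time spent in `B` before `D` is reached, up to time `t`. -/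
noncomputable def pathOcc (Z : ℝ≥0 → Ω → S) (D B : Set S) (t : ℝ≥0) (ω : Ω) : ℝ≥0∞ :=
  ∫⁻ r in Set.Ico (0 : ℝ) t,
    {r : ℝ | ENNReal.ofReal r < hitTime Z D ω ∧ Z r.toNNReal ω ∈ B}.indicator 1 r

lemma min_hitTime_le_gridOcc (Z : ℝ≥0 → Ω → S) (D : Set S) (δ : ℝ≥0) (j : ℕ) (ω : Ω) :
    min (hitTime Z D ω) ((j * δ : ℝ≥0) : ℝ≥0∞) ≤ gridOcc Z D Set.univ δ j ω := by
  induction j with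
  | zero => simp
  | succ j ih =>
    rw [gridOcc, Finset.sum_range_succ, ← gridOcc]
    by_cases h : ω ∈ gridAlive Z D Set.univ δ j
    · rw [Set.indicator_of_mem h, Pi.one_apply, mul_one]
      refine le_trans ?_ (add_le_add_left ih _)
      rw [min_add]
      refine min_le_min le_self_add (le_of_eq ?_)
      push_cast
      ring
    · rw [Set.indicator_of_notMem h, mul_zero, add_zero]
      refine le_trans ?_ ih
      simp only [gridAlive, Set.mem_univ, and_true, Set.mem_ofPred_eq, not_forall,
        not_not] at h
      obtain ⟨l, hl, hm⟩ := h
      refine (min_le_left _ _).trans (le_min le_rfl ((hitTime_le_of_mem hm).trans ?_))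
      gcongr

/-- When the observed process is in `D` at time `u`, the process itself has reached `D`, and by then
its clock, which is the time spent in `B`, has advanced by at most `u`. (If the clock never exceeds
`u`, then `clockInv` takes the value `0`, and the inequality still holds.) -/
lemma pathOcc_le_hitTime_observed (Z : ℝ≥0 → Ω → S) (D B : Set S) (t : ℝ≥0) (ω : Ω) :
    pathOcc Z D B t ω ≤ hitTime (observed Z B) D ω := by
  refine le_iInf₂ fun u hu => ?_
  set t₀ := clockInv Z B u ω with ht₀
  have hτ : hitTime Z D ω ≤ t₀ := hitTime_le_of_mem hu
  have h1 : pathOcc Z D B t ω ≤ clock Z B t₀ ω := by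
    rw [pathOcc, clock, ← lintegral_indicator measurableSet_Ico,
      ← lintegral_indicator measurableSet_Icc]
    refine lintegral_mono fun r => ?_
    by_cases h : r ∈ Set.Ico (0 : ℝ) t ∧
        r ∈ {r : ℝ | ENNReal.ofReal r < hitTime Z D ω ∧ Z r.toNNReal ω ∈ B}
    · have hlt : ENNReal.ofReal r < t₀ := h.2.1.trans_le hτ
      have : r ≤ t₀ := by
        rw [← ENNReal.ofReal_coe_nnreal] at hlt
        exact ((ENNReal.ofReal_lt_ofReal_iff_of_nonneg h.1.1).1 hlt).le
      rw [Set.indicator_of_mem h.1, Set.indicator_of_mem h.2,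
        Set.indicator_of_mem (show r ∈ Set.Icc (0 : ℝ) t₀ from ⟨h.1.1, this⟩),
        Set.indicator_of_mem h.2.2]
      rfl
    · have : (Set.Ico (0 : ℝ) t).indicator
          ({r : ℝ | ENNReal.ofReal r < hitTime Z D ω ∧ Z r.toNNReal ω ∈ B}.indicator
            (1 : ℝ → ℝ≥0∞)) r = 0 := by
        by_cases h' : r ∈ Set.Ico (0 : ℝ) t
        · rw [Set.indicator_of_mem h', Set.indicator_of_notMem fun h'' => h ⟨h', h''⟩]
        · rw [Set.indicator_of_notMem h']
      exact this.le.trans zero_le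
  refine h1.trans ?_
  -- the clock is continuous, and it is at most `u` strictly before `t₀`
  have h2 : ∀ q < t₀, clock Z B q ω ≤ u := fun q hq => by
    by_contra! hlt
    exact hq.not_ge (csInf_le (OrderBot.bddBelow _) hlt)
  rcases eq_or_ne t₀ 0 with h0 | h0
  · simp [clock, h0]
  refine ENNReal.le_of_forall_pos_le_add fun ε hε _ => ?_
  set q := t₀ - ε with hq
  have hqt : q < t₀ := tsub_lt_self (pos_iff_ne_zero.2 h0) hε
  have hsub : Set.Icc (0 : ℝ) t₀ ⊆ Set.Icc 0 q ∪ Set.Icc q t₀ := fun r hr => by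
    rcases le_total r q with h | h
    · exact Or.inl ⟨hr.1, h⟩
    · exact Or.inr ⟨h, hr.2⟩
  calc clock Z B t₀ ω
      ≤ ∫⁻ r in Set.Icc (0 : ℝ) q ∪ Set.Icc q t₀, B.indicator 1 (Z r.toNNReal ω) :=
        lintegral_mono_set hsub
    _ ≤ clock Z B q ω + ∫⁻ r in Set.Icc (q : ℝ) t₀, B.indicator 1 (Z r.toNNReal ω) :=
        lintegral_union_le _ _ _
    _ ≤ u + ∫⁻ _ in Set.Icc (q : ℝ) t₀, 1 := by
        refine add_le_add (h2 q hqt) (lintegral_mono fun r => ?_)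
        exact Set.indicator_le_self' (fun _ _ => zero_le) _
    _ ≤ u + ε := by
        gcongr
        rw [setLIntegral_one, Real.volume_Icc, ← NNReal.coe_sub hqt.le,
          ENNReal.ofReal_coe_nnreal, ENNReal.coe_le_coe]
        exact tsub_le_iff_left.2 (by rw [hq]; exact le_tsub_add)

lemma setLIntegral_floor (a : ℕ → ℝ≥0∞) {δ : ℝ≥0} (hδ : 0 < δ) (j : ℕ) :
    ∫⁻ r in Set.Ico (0 : ℝ) (j * δ : ℝ≥0), a ⌊r / δ⌋₊ = ∑ i ∈ Finset.range j, δ * a i := by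
  have hδ' : (0 : ℝ) < δ := hδ
  induction j with
  | zero => simp
  | succ j ih =>
    have hle : ((j * δ : ℝ≥0) : ℝ) ≤ ((j + 1 : ℕ) * δ : ℝ≥0) := by
      rw [NNReal.coe_le_coe]; gcongr; simp
    rw [← Set.Ico_union_Ico_eq_Ico (NNReal.coe_nonneg _) hle, lintegral_union measurableSet_Ico
      (Set.Ico_disjoint_Ico_same), ih, Finset.sum_range_succ]
    congr 1
    have hc : Set.EqOn (fun r : ℝ => a ⌊r / δ⌋₊) (fun _ => a j)
        (Set.Ico ((j * δ : ℝ≥0) : ℝ) ((j + 1 : ℕ) * δ : ℝ≥0)) := fun r hr => by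
      have h1 := hr.1
      have h2 := hr.2
      push_cast at h1 h2
      have : ⌊r / δ⌋₊ = j := by
        rw [Nat.floor_eq_iff (div_nonneg ((by positivity : (0 : ℝ) ≤ j * δ).trans h1) hδ'.le),
          le_div_iff₀ hδ', div_lt_iff₀ hδ']
        exact ⟨h1, h2⟩
      simp only [this]
    rw [setLIntegral_congr_fun measurableSet_Ico hc, setLIntegral_const, Real.volume_Ico]
    push_cast
    rw [add_mul, add_sub_cancel_left, one_mul, ENNReal.ofReal_coe_nnreal, mul_comm]

/-- The grid approximations of the time spent in `B` before `D` is reached are asymptotically not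
larger than the true value. Their terms are evaluated at the right ends of the grid cells, because
the paths are continuous from the right. -/
lemma limsup_gridOcc_le (hZ : ∀ t, ∀ᶠ u in 𝓝[≥] t, Z u ω = Z t ω) (D B : Set S) {t : ℝ≥0}
    {δ : ℕ → ℝ≥0} {j : ℕ → ℕ} (hpos : ∀ n, 0 < δ n) (hδ : Tendsto δ atTop (𝓝 0))
    (hj : ∀ n, j n * δ n = t) :
    limsup (fun n => gridOcc Z D B (δ n) (j n) ω) atTop ≤ pathOcc Z D B t ω := by
  have hδ' : Tendsto δ atTop (𝓝[>] 0) :=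
    tendsto_nhdsWithin_iff.2 ⟨hδ, Eventually.of_forall hpos⟩
  set a : ℕ → ℕ → ℝ≥0∞ := fun n i => (gridAlive Z D B (δ n) (i + 1)).indicator 1 ω with ha
  have ha1 : ∀ n i, a n i ≤ 1 := fun n i =>
    Set.indicator_le_self' (f := (1 : Ω → ℝ≥0∞)) (fun _ _ => zero_le) ω
  -- the grid sum is an integral, up to its first term
  have hsum : ∀ n, gridOcc Z D B (δ n) (j n) ω ≤
      δ n + ∫⁻ r in Set.Ico (0 : ℝ) t, a n ⌊r / δ n⌋₊ := fun n => by
    rw [← hj n, setLIntegral_floor _ (hpos n), gridOcc]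
    refine (Finset.sum_le_sum_of_subset (Finset.range_mono (Nat.le_succ _))).trans ?_
    rw [Finset.sum_range_succ', add_comm]
    gcongr
    exact mul_le_of_le_one_right zero_le
      (Set.indicator_le_self' (f := (1 : Ω → ℝ≥0∞)) (fun _ _ => zero_le) ω)
  have hlimδ : Tendsto (fun n => (δ n : ℝ≥0∞)) atTop (𝓝 0) := by
    simpa using ENNReal.tendsto_coe.2 hδ
  have hmeas : ∀ n, Measurable fun r : ℝ => a n ⌊r / δ n⌋₊ := fun n =>
    (measurable_from_nat (f := a n)).comp
      (Nat.measurable_floor.comp (measurable_id.div_const (δ n : ℝ)))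
  -- pointwise limits away from the time at which `D` is reached
  have hpt : ∀ᵐ r : ℝ ∂(volume.restrict (Set.Ico (0 : ℝ) t)),
      limsup (fun n => a n ⌊r / δ n⌋₊) atTop ≤
        {r : ℝ | ENNReal.ofReal r < hitTime Z D ω ∧ Z r.toNNReal ω ∈ B}.indicator 1 r := by
    have hne : ∀ᵐ r : ℝ ∂(volume.restrict (Set.Ico (0 : ℝ) t)), r ≠ (hitTime Z D ω).toReal :=
      ae_restrict_of_ae (Measure.ae_ne volume _)
    filter_upwards [hne, ae_restrict_mem measurableSet_Ico] with r hr hr0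
    lift r to ℝ≥0 using hr0.1
    by_cases hmem : (r : ℝ) ∈
        {r : ℝ | ENNReal.ofReal r < hitTime Z D ω ∧ Z r.toNNReal ω ∈ B}
    · rw [Set.indicator_of_mem hmem]
      exact limsup_le_of_le (by isBoundedDefault) (Eventually.of_forall fun n => ha1 n _)
    · rw [Set.indicator_of_notMem hmem]
      have hzero : ∀ᶠ n in atTop, a n ⌊(r : ℝ) / δ n⌋₊ = 0 := by
        have hfloor : ∀ n, ⌊(r : ℝ) / δ n⌋₊ = ⌊r / δ n⌋₊ := fun n => by
          refine Nat.floor_congr fun m => ?_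
          rw [← NNReal.coe_div]
          exact_mod_cast Iff.rfl
        simp only [hfloor]
        simp only [Set.mem_ofPred_eq, not_and_or, not_lt, ENNReal.ofReal_coe_nnreal,
          Real.toNNReal_coe] at hmem
        rcases hmem with h | h
        · have hlt : hitTime Z D ω < r := by
            refine lt_of_le_of_ne h fun heq => hr ?_
            rw [heq, ENNReal.coe_toReal]
          filter_upwards [hδ'.eventually (eventually_exists_nat_mul_mem hZ hlt)] with n hn
          obtain ⟨i, hi, hm⟩ := hn
          refine Set.indicator_of_notMem (fun hal => ?_) _
          refine hal.1 i (Nat.le_succ_of_le (Nat.le_floor ?_)) hm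
          rw [le_div_iff₀ (hpos n)]
          exact hi.le
        · obtain ⟨v, hv, hsub⟩ := (mem_nhdsGE_iff_exists_Ico_subset).1 (hZ r)
          have hv' : r < v := hv
          filter_upwards [hδ'.eventually (Ioo_mem_nhdsGT (tsub_pos_of_lt hv'))] with n hn
          refine Set.indicator_of_notMem (fun hal => h ?_) _
          have e : Z ((⌊r / δ n⌋₊ + 1 : ℕ) * δ n) ω = Z r ω := by
            refine hsub ⟨?_, ?_⟩
            · have := Nat.lt_floor_add_one (r / δ n)
              rw [div_lt_iff₀ (hpos n)] at this
              exact_mod_cast this.le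
            · have h1 : (⌊r / δ n⌋₊ : ℝ≥0) * δ n ≤ r := by
                rw [← le_div_iff₀ (hpos n)]
                exact Nat.floor_le zero_le
              calc ((⌊r / δ n⌋₊ + 1 : ℕ) : ℝ≥0) * δ n = ⌊r / δ n⌋₊ * δ n + δ n := by
                    push_cast; ring
                _ < r + (v - r) := add_lt_add_of_le_of_lt h1 hn.2
                _ = v := add_tsub_cancel_of_le hv'.le
          exact e ▸ hal.2
      rw [limsup_congr hzero, limsup_const]
  calc limsup (fun n => gridOcc Z D B (δ n) (j n) ω) atTop
      ≤ limsup (fun n => (δ n : ℝ≥0∞) + ∫⁻ r in Set.Ico (0 : ℝ) t, a n ⌊r / δ n⌋₊) atTop :=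
        limsup_le_limsup (Eventually.of_forall hsum)
    _ = limsup (fun n => ∫⁻ r in Set.Ico (0 : ℝ) t, a n ⌊r / δ n⌋₊) atTop :=
        ENNReal.limsup_add_of_left_tendsto_zero hlimδ _
    _ ≤ ∫⁻ r in Set.Ico (0 : ℝ) t, limsup (fun n => a n ⌊r / δ n⌋₊) atTop :=
        limsup_lintegral_le 1 hmeas (fun n => Eventually.of_forall fun r => ha1 n _) (by simp)
    _ ≤ pathOcc Z D B t ω := lintegral_mono_ae hpt

end Paths

/-! ### From the grid to continuous time -/

section Limit

open Filter Matrix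

lemma tendsto_div_two_pow (t : ℝ≥0) : Tendsto (fun n : ℕ => t / 2 ^ n) atTop (𝓝 0) := by
  have h : Tendsto (fun n : ℕ => t * (2⁻¹ : ℝ≥0) ^ n) atTop (𝓝 (t * 0)) :=
    (NNReal.tendsto_pow_atTop_nhds_zero_of_lt_one
      (by rw [← NNReal.coe_lt_coe]; norm_num)).const_mul t
  simpa [div_eq_mul_inv] using h

variable {S Ω : Type*} [Fintype S] [DecidableEq S] [MeasurableSpace Ω]
  {p : ℝ≥0 → Matrix S S ℝ} {P : S → Measure Ω} {Z : ℝ≥0 → Ω → S}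

namespace IsMarkovProcess

lemma measurableSet_gridAlive (hZ : IsMarkovProcess p P Z) (D B : Set S) (δ : ℝ≥0) (i : ℕ) :
    MeasurableSet (gridAlive Z D B δ i) := by
  have : gridAlive Z D B δ i =
      (⋂ (l : ℕ) (_ : l ≤ i), {ω | Z (l * δ) ω ∈ Dᶜ}) ∩ {ω | Z (i * δ) ω ∈ B} := by
    ext ω; simp [gridAlive]
  rw [this]
  exact (MeasurableSet.iInter fun l => MeasurableSet.iInter fun _ =>
    hZ.measurableSet_mem _ _).inter (hZ.measurableSet_mem _ _)

lemma measurable_gridOcc (hZ : IsMarkovProcess p P Z) (D B : Set S) (δ : ℝ≥0) (j : ℕ) :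
    Measurable (gridOcc Z D B δ j) := by
  unfold gridOcc
  exact Finset.measurable_fun_sum _ fun i _ =>
    ((measurable_const (a := (1 : ℝ≥0∞))).indicator
      (hZ.measurableSet_gridAlive D B δ i)).const_mul _

lemma lintegral_gridOcc (hZ : IsMarkovProcess p P Z) (D : Set S) (B : Finset S) (δ : ℝ≥0) (j : ℕ)
    (x : S) :
    ∫⁻ ω, gridOcc Z D B δ j ω ∂(P x) =
      ENNReal.ofReal (δ * occ (p δ) D ((B : Set S).indicator 1) j x) := by
  have hmeas : ∀ i, Measurable ((gridAlive Z D B δ i).indicator (1 : Ω → ℝ≥0∞)) := fun i =>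
    (measurable_const (a := (1 : ℝ≥0∞))).indicator (hZ.measurableSet_gridAlive D B δ i)
  simp only [gridOcc]
  rw [lintegral_finsetSum _ fun i _ => (hmeas i).const_mul _, occ, Finset.sum_apply,
    Finset.mul_sum, ENNReal.ofReal_sum_of_nonneg fun i _ => mul_nonneg δ.coe_nonneg
      (killed_mulVec_nonneg (hZ.stochastic δ) D (f := (B : Set S).indicator 1)
        (fun w => Set.indicator_nonneg (fun _ _ => zero_le_one) w) i x)]
  refine Finset.sum_congr rfl fun i _ => ?_
  rw [lintegral_const_mul _ (hmeas i), lintegral_indicator_one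
    (hZ.measurableSet_gridAlive D B δ i), ENNReal.ofReal_mul δ.coe_nonneg, ENNReal.ofReal_coe_nnreal,
    ← hZ.measure_grid_mem]
  rfl

/-- An inequality between expected times of the chains sampled on finer and finer grids passes to
the limit. -/
lemma lintegral_hitTime_le (hZ : IsMarkovProcess p P Z) (D : Set S) (B : Finset S) {b : S → ℝ}
    (hb : ∀ w, 0 ≤ b w) {C : ℝ} (hC : 0 ≤ C) {T : ℝ≥0} (hT : 0 < T)
    (h : ∀ (n j : ℕ) (z : S), ((T / 2 ^ n : ℝ≥0) : ℝ) * occ (p (T / 2 ^ n)) D 1 j z ≤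
      C + ∑ w, b w * (((T / 2 ^ n : ℝ≥0) : ℝ) *
        occ (p (T / 2 ^ n)) D ((B : Set S).indicator 1) j w)) (z : S) :
    ∫⁻ ω, hitTime Z D ω ∂(P z) ≤
      ENNReal.ofReal C +
        ∑ w, ENNReal.ofReal (b w) * ∫⁻ ω, hitTime (observed Z B) D ω ∂(P w) := by
  have hfin := hZ.isProbabilityMeasure
  have hτ : Measurable (hitTime Z D) :=
    measurable_hitTime hZ.rightContinuous fun t => hZ.measurableSet_mem t D
  set m : Measure Ω := ∑ w, ENNReal.ofReal (b w) • P w with hm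
  have hmint : ∀ f : Ω → ℝ≥0∞,
      ∫⁻ ω, f ω ∂m = ∑ w, ENNReal.ofReal (b w) * ∫⁻ ω, f ω ∂(P w) := fun f => by
    rw [hm, lintegral_finsetSum_measure]
    simp only [lintegral_smul_measure, smul_eq_mul]
  have hmfin : m Set.univ ≠ ∞ := by
    have := hmint 1
    simp only [Pi.one_apply, lintegral_one, measure_univ, mul_one] at this
    rw [this]
    exact ENNReal.sum_ne_top.2 fun w _ => ENNReal.ofReal_ne_top
  rw [← hmint]
  -- truncation of the hitting time at `M T`
  have hsup : ∫⁻ ω, hitTime Z D ω ∂(P z) =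
      ⨆ M : ℕ, ∫⁻ ω, min (hitTime Z D ω) ((M * T : ℝ≥0) : ℝ≥0∞) ∂(P z) := by
    rw [← lintegral_iSup fun M => hτ.min measurable_const]
    · refine lintegral_congr fun ω => ?_
      have htend : Tendsto (fun M : ℕ => ((M * T : ℝ≥0) : ℝ≥0∞)) atTop (𝓝 ∞) := by
        refine ENNReal.tendsto_coe_nhds_top.2 ?_
        exact (tendsto_natCast_atTop_atTop (R := ℝ≥0)).atTop_mul_const hT
      have hmin : Tendsto (fun M : ℕ => min (hitTime Z D ω) ((M * T : ℝ≥0) : ℝ≥0∞)) atTop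
          (𝓝 (hitTime Z D ω)) := by
        simpa using tendsto_const_nhds.min htend
      refine (tendsto_nhds_unique (tendsto_atTop_iSup fun i j hij => ?_) hmin).symm
      gcongr
    · intro i j hij ω
      dsimp only
      gcongr
  rw [hsup]
  refine iSup_le fun M => ?_
  set δ : ℕ → ℝ≥0 := fun n => T / 2 ^ n with hδ
  have hpos : ∀ n, 0 < δ n := fun n => by positivity
  have hj : ∀ n, ((M * 2 ^ n : ℕ) : ℝ≥0) * δ n = M * T := fun n => by
    simp only [hδ]; push_cast; field_simp
  have hlim : Tendsto δ atTop (𝓝 0) := tendsto_div_two_pow T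
  set I : ℝ≥0∞ := ∫⁻ ω, min (hitTime Z D ω) ((M * T : ℝ≥0) : ℝ≥0∞) ∂(P z) with hI
  have hn : ∀ n, I - ENNReal.ofReal C ≤ ∫⁻ ω, gridOcc Z D B (δ n) (M * 2 ^ n) ω ∂m := fun n => by
    rw [tsub_le_iff_left]
    have h1 : I ≤ ENNReal.ofReal (δ n * occ (p (δ n)) D 1 (M * 2 ^ n) z) := by
      have h2 := hZ.lintegral_gridOcc D Finset.univ (δ n) (M * 2 ^ n) z
      rw [Finset.coe_univ, Set.indicator_univ] at h2
      rw [← h2]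
      refine lintegral_mono fun ω => ?_
      rw [← hj n]
      exact min_hitTime_le_gridOcc Z D (δ n) _ ω
    refine h1.trans ((ENNReal.ofReal_le_ofReal (h n _ z)).trans ?_)
    have hocc : ∀ w, 0 ≤ (δ n : ℝ) * occ (p (δ n)) D ((B : Set S).indicator 1) (M * 2 ^ n) w :=
      fun w => mul_nonneg (NNReal.coe_nonneg _) (occ_nonneg (hZ.stochastic _) D
        (fun v => Set.indicator_nonneg (fun _ _ => zero_le_one) v) _ w)
    rw [ENNReal.ofReal_add hC (Finset.sum_nonneg fun w _ => mul_nonneg (hb w) (hocc w)),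
      ENNReal.ofReal_sum_of_nonneg fun w _ => mul_nonneg (hb w) (hocc w), hmint]
    refine add_le_add le_rfl (le_of_eq (Finset.sum_congr rfl fun w _ => ?_))
    rw [ENNReal.ofReal_mul (hb w), hZ.lintegral_gridOcc]
  rw [← tsub_le_iff_left]
  calc I - ENNReal.ofReal C
      = limsup (fun _ : ℕ => I - ENNReal.ofReal C) atTop := limsup_const _ |>.symm
    _ ≤ limsup (fun n => ∫⁻ ω, gridOcc Z D B (δ n) (M * 2 ^ n) ω ∂m) atTop :=
        limsup_le_limsup (Eventually.of_forall hn)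
    _ ≤ ∫⁻ ω, limsup (fun n => gridOcc Z D B (δ n) (M * 2 ^ n) ω) atTop ∂m := by
        refine limsup_lintegral_le (fun _ => ((M * T : ℝ≥0) : ℝ≥0∞))
          (fun n => hZ.measurable_gridOcc D B _ _) (fun n => Eventually.of_forall fun ω => ?_) ?_
        · rw [← hj n]
          refine (Finset.sum_le_card_nsmul _ _ (δ n : ℝ≥0∞) fun i _ => ?_).trans ?_
          · exact mul_le_of_le_one_right zero_le
              (Set.indicator_le_self' (f := (1 : Ω → ℝ≥0∞)) (fun _ _ => zero_le) ω)
          · rw [Finset.card_range, nsmul_eq_mul]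
            push_cast
            exact le_rfl
        · rw [lintegral_const]
          exact ENNReal.mul_ne_top ENNReal.coe_ne_top hmfin
    _ ≤ ∫⁻ ω, hitTime (observed Z B) D ω ∂m := lintegral_mono fun ω =>
        (limsup_gridOcc_le (hZ.rightContinuous ω) D B hpos hlim hj).trans
          (pathOcc_le_hitTime_observed Z D B _ ω)

/-- First-passage bound in continuous time: if `p r u` stays above `c` at `s` for `r ≤ t`, then
`p t u` is everywhere at least `c` times the probability that `s` is reached by time `t`, which
Markov's inequality bounds from below. -/
lemma le_mulVec_of_le_at (hZ : IsMarkovProcess p P Z)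
    (hpow : ∀ (δ : ℝ≥0) (k : ℕ), p (k * δ) = p δ ^ k) {s : S} {h : ℝ≥0} (x : S)
    (hh : ∫⁻ ω, hitTime Z {s} ω ∂(P x) ≤ h) {t : ℝ≥0} (ht : 0 < t) {u : S → ℝ}
    (hu : ∀ z, 0 ≤ u z) {c : ℝ} (hc : 0 ≤ c) (hs : ∀ r ≤ t, c ≤ (p r *ᵥ u) s) :
    c * (1 - h / t) ≤ (p t *ᵥ u) x := by
  have hprob := hZ.isProbabilityMeasure x
  set δ : ℕ → ℝ≥0 := fun n => t / 2 ^ n with hδ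
  have hpos : ∀ n, 0 < δ n := fun n => by positivity
  have hδt : ∀ n, ((2 ^ n : ℕ) : ℝ≥0) * δ n = t := fun n => by
    simp only [hδ]; push_cast; field_simp
  set E : ℕ → Set Ω := fun n => {ω | ∀ i : ℕ, i ≤ 2 ^ n → Z (i * δ n) ω ∉ ({s} : Set S)} with hE
  have hEm : ∀ n, MeasurableSet (E n) := fun n => by
    simp only [hE, Set.ofPred_forall]
    exact MeasurableSet.iInter fun i => MeasurableSet.iInter fun _ =>
      hZ.measurableSet_mem _ {s}ᶜ
  have hEanti : Antitone E := fun m n hmn ω hω i hi => by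
    obtain ⟨k, rfl⟩ := Nat.exists_eq_add_of_le hmn
    have := hω (i * 2 ^ k) (by rw [pow_add]; gcongr)
    convert this using 3
    simp only [hδ]
    push_cast
    rw [pow_add]
    field_simp
  -- the discrete first-passage bound on each grid
  have hgrid : ∀ n, c * (1 - (P x).real (E n)) ≤ (p t *ᵥ u) x := fun n => by
    have h1 := le_pow_mulVec_of_le_on (hZ.stochastic (δ n)) {s} hu (c := c) (2 ^ n)
      (fun k hk s' hs' => by
        rw [Set.mem_singleton_iff.1 hs', ← hpow]
        refine hs _ ?_
        rw [← hδt n]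
        gcongr) x
    rw [← hpow, hδt] at h1
    have h2 : (P x).real (E n) = (killed (p (δ n)) {s} (2 ^ n) *ᵥ 1) x := by
      simp only [Measure.real, hE]
      rw [hZ.measure_grid_univ, ENNReal.toReal_ofReal
      (killed_mulVec_nonneg (hZ.stochastic _) _ (f := 1) (fun _ => zero_le_one) _ _)]
    rwa [h2]
  have hlim : Tendsto (fun n => (P x).real (E n)) atTop (𝓝 ((P x).real (⋂ n, E n))) :=
    (ENNReal.tendsto_toReal (measure_ne_top _ _)).comp
      (tendsto_measure_iInter_atTop (fun n => (hEm n).nullMeasurableSet) hEanti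
        ⟨0, measure_ne_top _ _⟩)
  have hle : c * (1 - (P x).real (⋂ n, E n)) ≤ (p t *ᵥ u) x :=
    le_of_tendsto' ((hlim.const_sub 1).const_mul c) hgrid
  -- a path that avoids `s` on all grids has not reached `s` before time `t`
  have hsub : ∀ ω ∈ ⋂ n, E n, (t : ℝ≥0∞) ≤ hitTime Z {s} ω := fun ω hω => by
    by_contra! hlt
    have hδ' : Tendsto δ atTop (𝓝[>] 0) :=
      tendsto_nhdsWithin_iff.2 ⟨tendsto_div_two_pow t, Eventually.of_forall hpos⟩
    obtain ⟨n, i, hi, hm⟩ :=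
      (hδ'.eventually (eventually_exists_nat_mul_mem (hZ.rightContinuous ω) hlt)).exists
    refine Set.mem_iInter.1 hω n i ?_ hm
    have hi' : (i : ℝ≥0) * δ n < ((2 ^ n : ℕ) : ℝ≥0) * δ n := by rwa [hδt]
    exact_mod_cast (lt_of_mul_lt_mul_right hi' (hpos n).le).le
  have hmarkov : (t : ℝ≥0∞) * P x (⋂ n, E n) ≤ h := by
    refine le_trans ?_ hh
    rw [← lintegral_indicator_const (MeasurableSet.iInter hEm)]
    refine lintegral_mono fun ω => ?_
    by_cases hω : ω ∈ ⋂ n, E n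
    · rw [Set.indicator_of_mem hω]
      exact hsub ω hω
    · rw [Set.indicator_of_notMem hω]
      exact zero_le
  have hreal : (P x).real (⋂ n, E n) ≤ h / t := by
    have := ENNReal.toReal_mono ENNReal.coe_ne_top hmarkov
    rw [ENNReal.toReal_mul, ENNReal.coe_toReal, ENNReal.coe_toReal] at this
    rw [le_div_iff₀ (by exact_mod_cast ht), mul_comm]
    exact this
  refine le_trans ?_ hle
  gcongr

end IsMarkovProcess

end Limit

/-! ### Mixing within a multiple of the hitting time -/

section Mixing

open Matrix

variable {V Ω : Type*} [Fintype V] [DecidableEq V] [MeasurableSpace Ω]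
  {Q : Matrix V V ℝ} {π : V → ℝ} {P : V → Measure Ω} {X : ℝ≥0 → Ω → V}

/-- Ten times the expected hitting time of one state is enough for the chain to reach every state
with probability comparable to `π`. By the first-passage bound, the chain is at `s` at time `5 h`
with probability at least `4 / 5 * π s`; by reversibility the same holds for moving from `s` to
`y`, and the first-passage bound applies again. -/
lemma le_trans_of_tHit_le (hQ : IsGenerator Q) (hX : IsMarkovChain Q P X)
    (hrev : IsReversible Q π) (hpos : ∀ i, 0 < π i) (hsum : ∑ i, π i = 1) {s : V} {h : ℝ≥0}
    (h0 : 0 < h) (hh : tHit P X s ≤ h) (x y : V) : 16 / 25 * π y ≤ trans Q (10 * h) x y := by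
  have hZ := hX.isMarkovProcess hQ
  have hh' : ∀ x, ∫⁻ ω, hitTime X {s} ω ∂(P x) ≤ h := fun x =>
    (le_iSup (fun x => ∫⁻ ω, hitTime X {s} ω ∂(P x)) x).trans hh
  have hsingle : ∀ v z : V, 0 ≤ (Pi.single v 1 : V → ℝ) z := fun v z => by
    by_cases hz : z = v <;> simp [hz]
  have hfrac : ∀ t : ℝ≥0, 5 * h ≤ t → (4 / 5 : ℝ) ≤ 1 - h / t := fun t ht => by
    have hh0 : (0 : ℝ) < h := h0
    have ht' : 5 * (h : ℝ) ≤ t := by exact_mod_cast ht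
    have : (h : ℝ) / t ≤ 1 / 5 := by
      rw [div_le_div_iff₀ (by linarith) (by norm_num)]; linarith
    linarith
  have hone : ∀ t : ℝ≥0, 5 * h ≤ t → ∀ x, 4 / 5 * π s ≤ trans Q t x s := fun t ht x => by
    have h1 := hZ.le_mulVec_of_le_at trans_nat_mul x (hh' x) (t := t)
      (lt_of_lt_of_le (by positivity) ht) (hsingle s) (c := π s) (hpos s).le
      (fun r _ => by simpa using hrev.le_trans_self hQ hpos hsum r s)
    rw [mulVec_single_one] at h1
    refine le_trans ?_ h1
    nlinarith [hfrac t ht, hpos s]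
  have hfrom : ∀ t : ℝ≥0, 5 * h ≤ t → 4 / 5 * π y ≤ trans Q t s y := fun t ht => by
    have h1 := hone t ht y
    have h2 := hrev.trans t s y
    have h3 := hpos s
    have h4 := hpos y
    refine le_of_mul_le_mul_left ?_ h3
    rw [h2]
    nlinarith
  have h5 : (0 : ℝ≥0) < 5 * h := by positivity
  have h1 := hZ.le_mulVec_of_le_at trans_nat_mul x (hh' x) h5
    (u := trans Q (5 * h) *ᵥ Pi.single y 1) (fun z => by
      rw [mulVec_single_one]
      exact nonneg_of_mem_rowStochastic (hZ.stochastic _))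
    (c := 4 / 5 * π y) (by linarith [hpos y]) (fun r _ => by
      rw [mulVec_mulVec, ← trans_add, mulVec_single_one]
      exact hfrom _ le_add_self)
  rw [mulVec_mulVec, ← trans_add, mulVec_single_one, ← add_mul] at h1
  norm_num at h1
  refine le_trans ?_ h1
  have := hfrac (5 * h) le_rfl
  push_cast at this
  nlinarith [hpos y]

end Mixing

/-! ### Meeting times -/

section Meeting

open Matrix

variable {V Ω : Type*} [Fintype V] [DecidableEq V] [MeasurableSpace Ω]
  {Q : Matrix V V ℝ} {π : V → ℝ} {P : V → Measure Ω} {X : ℝ≥0 → Ω → V}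

lemma kronecker_self_pow (M : Matrix V V ℝ) (k : ℕ) :
    kroneckerMap (· * ·) M M ^ k = kroneckerMap (· * ·) (M ^ k) (M ^ k) := by
  induction k with
  | zero => simp
  | succ k ih =>
    rw [pow_succ, ih, pow_succ]
    exact (mul_kronecker_mul _ _ _ _).symm

/-- Passage to continuous time of an inequality between killed sums of the pair of chains on the
grids with `2 ^ n` points per time `10 h`. The constant is `74 ≥ 3 * 10 * (625 / 256)`. -/
lemma tMeet_le_of_occ_le (hQ : IsGenerator Q) (hX : IsMarkovChain Q P X) (A : Finset V)
    {ν : V → ℝ} (hν : ∀ i, 0 ≤ ν i) {a : ℝ} (ha : 0 < a) {h : ℝ≥0} (h0 : 0 < h)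
    (hocc : ∀ (n j : ℕ) (z : V × V),
      occ (kroneckerMap (· * ·) (trans Q (10 * h / 2 ^ n)) (trans Q (10 * h / 2 ^ n)))
          (Set.diagonal V) 1 j z ≤
        3 * ((2 ^ n : ℕ) / (256 / 625 * a)) + (∑ w : V × V, ν w.1 * ν w.2 *
          occ (kroneckerMap (· * ·) (trans Q (10 * h / 2 ^ n)) (trans Q (10 * h / 2 ^ n)))
            (Set.diagonal V) (((A ×ˢ A : Finset (V × V)) : Set (V × V)).indicator 1) j w) / a) :
    tMeet P X ≤ ENNReal.ofReal (74 * h / a) + tMeetObs P X A ν / ENNReal.ofReal a := by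
  have hZ := hX.isMarkovProcess_pair hQ
  have hh0 : (0 : ℝ) < h := h0
  refine iSup₂_le fun x y => ?_
  have key := hZ.lintegral_hitTime_le (Set.diagonal V) (A ×ˢ A)
    (b := fun w => ν w.1 * ν w.2 / a)
    (fun w => div_nonneg (mul_nonneg (hν _) (hν _)) ha.le) (C := 74 * h / a) (by positivity)
    (T := 10 * h) (by positivity) (fun n j z => by
      refine (mul_le_mul_of_nonneg_left (hocc n j z) (NNReal.coe_nonneg _)).trans ?_
      rw [mul_add]
      refine add_le_add ?_ (le_of_eq ?_)
      · push_cast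
        rw [show (10 * (h : ℝ) / 2 ^ n) * (3 * (2 ^ n / (256 / 625 * a))) =
          (18750 / 256 * h) / a by field_simp; norm_num]
        gcongr
        norm_num
      · rw [Finset.sum_div, Finset.mul_sum]
        exact Finset.sum_congr rfl fun w _ => by ring) (x, y)
  refine key.trans (add_le_add le_rfl (le_of_eq ?_))
  rw [tMeetObs, ENNReal.div_eq_inv_mul, Finset.mul_sum, Fintype.sum_prod_type]
  refine Finset.sum_congr rfl fun u _ => ?_
  rw [Finset.mul_sum]
  refine Finset.sum_congr rfl fun v _ => ?_
  rw [div_eq_inv_mul, ENNReal.ofReal_mul (inv_nonneg.2 ha.le), ENNReal.ofReal_inv_of_pos ha,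
    mul_assoc]
  simp only [obsMeetTime, Finset.coe_product]

/-- Both estimates, for any `h > 0` that bounds the hitting time. The pair of chains satisfies a
Doeblin condition after time `10 h` with the constant `(16 / 25) ^ 2 = 256 / 625`. -/
lemma tMeet_le_of_tHit_le (hQ : IsGenerator Q) (hX : IsMarkovChain Q P X)
    (hrev : IsReversible Q π) (hpos : ∀ i, 0 < π i) (hsum : ∑ i, π i = 1) {s : V} {h : ℝ≥0}
    (h0 : 0 < h) (hh : tHit P X s ≤ h) (A : Finset V) (hA : A.Nonempty) {ν : V → ℝ}
    (hν : ν = condDist π A ∨ ν = π) :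
    tMeet P X ≤ ENNReal.ofReal (74 * h / (∑ i ∈ A, π i) ^ 2) +
      tMeetObs P X A ν / ENNReal.ofReal ((∑ i ∈ A, π i) ^ 2) := by
  have hc : 0 < ∑ i ∈ A, π i := Finset.sum_pos (fun i _ => hpos i) hA
  set c := ∑ i ∈ A, π i with hcdef
  have hZ := hX.isMarkovProcess_pair hQ
  set μ : V × V → ℝ := fun z => π z.1 * π z.2 with hμ
  have hμ1 : ∑ z, μ z = 1 := by
    simp only [hμ, Fintype.sum_prod_type, ← Finset.mul_sum, hsum, mul_one]
  have hμA : ∑ z ∈ A ×ˢ A, μ z = c ^ 2 := by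
    simp only [hμ, Finset.sum_product, ← Finset.mul_sum, ← Finset.sum_mul, hcdef, sq]
  have hstep : ∀ n : ℕ, trans Q (10 * h / 2 ^ n) ^ 2 ^ n = trans Q (10 * h) := fun n => by
    rw [← trans_nat_mul]
    congr 1
    push_cast
    field_simp
  have hmin : ∀ (n : ℕ) (z w : V × V), 256 / 625 * μ w ≤
      (kroneckerMap (· * ·) (trans Q (10 * h / 2 ^ n)) (trans Q (10 * h / 2 ^ n)) ^ 2 ^ n) z w :=
    fun n z w => by
      rw [kronecker_self_pow, hstep, kroneckerMap_apply]
      have h1 := le_trans_of_tHit_le hQ hX hrev hpos hsum h0 hh z.1 w.1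
      have h2 := le_trans_of_tHit_le hQ hX hrev hpos hsum h0 hh z.2 w.2
      refine le_trans (le_of_eq ?_) (mul_le_mul h1 h2 (by linarith [hpos w.2])
        (le_trans (by linarith [hpos w.1]) h1))
      simp only [hμ]
      ring
  have hrevμ : ∀ (t : ℝ≥0) (z w : V × V),
      μ z * kroneckerMap (· * ·) (trans Q t) (trans Q t) z w =
        μ w * kroneckerMap (· * ·) (trans Q t) (trans Q t) w z := fun t z w => by
    simp only [hμ, kroneckerMap_apply]
    linear_combination (π z.2 * trans Q t z.2 w.2) * hrev.trans t z.1 w.1 +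
      (π w.1 * trans Q t w.1 z.1) * hrev.trans t z.2 w.2
  have hν0 : ∀ i, 0 ≤ ν i := by
    rcases hν with rfl | rfl
    · intro i
      unfold condDist
      split_ifs
      · exact div_nonneg (hpos i).le hc.le
      · exact le_rfl
    · exact fun i => (hpos i).le
  refine tMeet_le_of_occ_le hQ hX A hν0 (by positivity) h0 fun n j z => ?_
  rcases hν with rfl | rfl
  · refine (occ_one_le_conditioned (hZ.stochastic (10 * h / 2 ^ n)) (hrevμ _)
      (fun w => mul_nonneg (hpos _).le (hpos _).le) hμ1 (by norm_num) (by norm_num)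
      (by positivity) (hmin n) (Set.diagonal V) (A ×ˢ A) (by positivity) hμA j z).trans
      (le_of_eq ?_)
    congr 2
    rw [Finset.sum_div, ← Finset.sum_subset (Finset.subset_univ (A ×ˢ A))]
    · refine Finset.sum_congr rfl fun w hw => ?_
      rw [Finset.mem_product] at hw
      simp only [condDist, hw.1, hw.2, if_true, hμ, ← hcdef]
      field_simp
    · intro w _ hw
      rw [Finset.mem_product, not_and_or] at hw
      rcases hw with hw | hw <;> simp [condDist, hw]
  · refine (occ_one_le_stationary (hZ.stochastic (10 * h / 2 ^ n)) (hrevμ _) (by norm_num)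
      (hmin n) (Set.diagonal V) (A ×ˢ A) (by positivity) hμA j z).trans ?_
    refine add_le_add ?_ le_rfl
    exact le_mul_of_one_le_left (by positivity) (by norm_num)

lemma tMeet_le_add (hQ : IsGenerator Q) (hX : IsMarkovChain Q P X)
    (hrev : IsReversible Q π) (hpos : ∀ i, 0 < π i) (hsum : ∑ i, π i = 1) (s : V)
    (A : Finset V) (hA : A.Nonempty) {ν : V → ℝ} (hν : ν = condDist π A ∨ ν = π) :
    tMeet P X ≤ 188 * tHit P X s + 2 * tMeetObs P X A ν / ENNReal.ofReal (∑ i ∈ A, π i) ^ 2 +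
      1568 * tHit P X s / ENNReal.ofReal (∑ i ∈ A, π i) ^ 4 := by
  have hc : 0 < ∑ i ∈ A, π i := Finset.sum_pos (fun i _ => hpos i) hA
  have hc1 : ∑ i ∈ A, π i ≤ 1 := by
    rw [← hsum]
    exact Finset.sum_le_sum_of_subset_of_nonneg (Finset.subset_univ _) fun i _ _ => (hpos i).le
  have hbound := fun (h : ℝ≥0) h0 hh =>
    tMeet_le_of_tHit_le (h := h) (s := s) hQ hX hrev hpos hsum h0 hh A hA hν
  generalize (∑ i ∈ A, π i) = c at hc hc1 hbound ⊢
  by_cases htop : tHit P X s = ∞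
  · simp [htop]
  lift tHit P X s to ℝ≥0 using htop with H
  have hmain : tMeet P X ≤
      ENNReal.ofReal (74 * H / c ^ 2) + tMeetObs P X A ν / ENNReal.ofReal (c ^ 2) := by
    refine ENNReal.le_of_forall_pos_le_add fun ε hε _ => ?_
    -- the bound needs `h > 0`, while the hitting time vanishes if `s` is the only state
    have hε' : (0 : ℝ) < ε := hε
    obtain ⟨η, hη⟩ : ∃ η : ℝ≥0, (η : ℝ) = ε * c ^ 2 / 74 :=
      ⟨_, Real.coe_toNNReal _ (by positivity)⟩
    have hη0 : 0 < η := by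
      rw [← NNReal.coe_pos, hη]; positivity
    have h1 := hbound (H + η) (add_pos_of_nonneg_of_pos zero_le hη0) (by
        rw [ENNReal.coe_le_coe]; exact le_self_add)
    refine h1.trans (le_of_eq ?_)
    have e : 74 * ((H + η : ℝ≥0) : ℝ) / c ^ 2 = 74 * H / c ^ 2 + ε := by
      rw [NNReal.coe_add, hη]
      field_simp
    rw [e, ENNReal.ofReal_add (by positivity) ε.coe_nonneg, ENNReal.ofReal_coe_nnreal]
    ring
  refine hmain.trans ?_
  rw [ENNReal.ofReal_pow hc.le, add_assoc, add_comm (2 * _ / _)]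
  refine le_trans (add_le_add ?_ ?_) le_add_self
  · have hH : 74 * (H : ℝ) / c ^ 2 ≤ 1568 * H / c ^ 4 := by
      have : c ^ 4 ≤ c ^ 2 := pow_le_pow_of_le_one hc.le hc1 (by norm_num)
      gcongr
      norm_num
    refine (ENNReal.ofReal_le_ofReal hH).trans (le_of_eq ?_)
    rw [ENNReal.ofReal_div_of_pos (by positivity), ENNReal.ofReal_pow hc.le,
      ENNReal.ofReal_mul (by norm_num), ENNReal.ofReal_coe_nnreal]
    norm_num
  · gcongr
    exact le_mul_of_one_le_left zero_le (by norm_num)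

end Meeting

end CTMC

theorem mainTheorem3 {V Ω : Type*} [Fintype V] [DecidableEq V] [MeasurableSpace Ω]
    (Q : Matrix V V ℝ) (hQ : CTMC.IsGenerator Q) (hirr : CTMC.IsIrreducible Q)
    (π : V → ℝ) (hπ : CTMC.IsInvariant Q π) (hrev : CTMC.IsReversible Q π)
    (P : V → Measure Ω) (X : ℝ≥0 → Ω → V) (hX : CTMC.IsMarkovChain Q P X)
    (s : V) (A : Finset V) (hA : A.Nonempty) :
    (CTMC.tMeet P X ≤
      188 * CTMC.tHit P X s
        + 2 * CTMC.tMeetObs P X A (CTMC.condDist π A) / ENNReal.ofReal (∑ i ∈ A, π i) ^ 2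
        + 1568 * CTMC.tHit P X s / ENNReal.ofReal (∑ i ∈ A, π i) ^ 4) ∧
    (CTMC.tMeet P X ≤
      188 * CTMC.tHit P X s
        + 2 * CTMC.tMeetObs P X A π / ENNReal.ofReal (∑ i ∈ A, π i) ^ 2
        + 1568 * CTMC.tHit P X s / ENNReal.ofReal (∑ i ∈ A, π i) ^ 4) :=
  have hpos := hπ.pos hirr hrev
  ⟨CTMC.tMeet_le_add hQ hX hrev hpos hπ.sum_one s A hA (Or.inl rfl),
    CTMC.tMeet_le_add hQ hX hrev hpos hπ.sum_one s A hA (Or.inr rfl)⟩
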